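/- Call a rational $n$-tuple $(\varphi_1,\dots,\varphi_n)\in\mathbb Q^n$ an \emph{irreducible solution} of $$\text{(C)}\ \ \sum_{j=1}^n\cos 2\pi\varphi_j=0\qquad\Bigl(\text{resp. of (E)}\ \ \sum_{j=1}^n e^{2\pi i\varphi_j}=0\Bigr)$$ if it satisfies the equation while $\sum_{j\in E}\cos2\pi\varphi_j\ne0$ (resp. $\sum_{j\in E}e^{2\pi i\varphi_j}\neq0$) for every nonempty proper subset $E\subset\{1,\dots,n\}$. Entries are considered modulo $1$. For (E), two $n$-tuples are equivalent if they differ by a permutation. For (C), two $n$-tuples are equivalent if they are related by permutations, changes $\varphi_j\mapsto 1-\varphi_j$ of individual entries, and the simultaneous change $\varphi_j\mapsto\frac12-\varphi_j$ of all entries. \textbf{(1)} For $1\le n\le 6$, a rational $n$-tuple is an irreducible solution of (E) if and only if it is equivalent to one of the following, for some $\varphi\in\mathbb Q$: \begin{itemize} \item $(\varphi-\frac16,\varphi+\frac16,\varphi+\frac15,\varphi+\frac25,\varphi+\frac35,\varphi+\frac45)$, \item $(\varphi,\varphi+\frac15,\varphi+\frac25,\varphi+\frac35,\varphi+\frac45)$,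 \item $(\varphi,\varphi+\frac13,\varphi+\frac23)$, \item $(\varphi,\varphi+\frac12)$. \end{itemize} \textbf{(2)} For $1<n\le6$, every irreducible rational solution of (C) is equivalent to one of the following: \begin{itemize} \item one of the 13 sporadic 6-tuples $(\frac1{11},\frac2{11},\frac3{11},\frac4{11},\frac5{11},\frac16)$; $(\frac L7+\frac16,\frac L7-\frac16,\frac{2L}7,\frac{3L}7,0,\frac13)$, $(\frac L7+\frac16,\frac L7-\frac16,\frac{2L}7,\frac{3L}7,\frac1{10},\frac3{10})$, $(\frac L7+\frac16,\frac L7-\frac16,\frac{2L}7+\frac16,\frac{2L}7-\frac16,\frac{3L}7,\frac16)$ with $L=1,2,3$; $(\frac17,\frac27,\frac37,0,\frac15,\frac25)$, $(\frac17,\frac27,\frac37,\frac1{15},\frac4{15},\frac3{10})$, $(\frac17,\frac27,\frac37,\frac1{10},\frac2{15},\frac7{15})$; or a member of the family $\mathrm{VI}_\varphi=(\varphi+\frac16,\varphi-\frac16,\varphi+\frac15,\varphi+\frac25,\varphi+\frac35,\varphi+\frac45)$, $\varphi\in\mathbb Q$; \item one of the 7 sporadic 5-tuples $(0,\frac1{30},\frac13,\frac{11}{30},\frac25)$,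 $(0,\frac15,\frac7{30},\frac13,\frac{13}{30})$; $(\frac L7+\frac16,\frac L7-\frac16,\frac{2L}7,\frac{3L}7,\frac16)$ with $L=1,2,3$; $(\frac17,\frac27,\frac37,0,\frac13)$, $(\frac17,\frac27,\frac37,\frac1{10},\frac3{10})$; or a member of the family $\mathrm V_\varphi=(\varphi,\varphi+\frac15,\varphi+\frac25,\varphi+\frac35,\varphi+\frac45)$, $\varphi\in\mathbb Q$; \item one of the 4 sporadic quadruples $(0,\frac15,\frac13,\frac25)$, $(\frac1{30},\frac16,\frac{11}{30},\frac25)$, $(\frac1{15},\frac4{15},\frac3{10},\frac13)$, $(\frac17,\frac27,\frac37,\frac16)$; \item the sporadic triple $\mathrm{III}_1=(\frac1{10},\frac3{10},\frac13)$, or a member of the family $\mathrm{III}_\varphi=(\varphi,\varphi+\frac13,\varphi-\frac13)$, $\varphi\in\mathbb Q$; \item a member of the family of pairs $\mathrm{II}_\varphi=(\varphi,\frac12-\varphi)$, $\varphi\in\mathbb Q$. \end{itemize} Moreover, all sporadic tuples listed are irreducible solutions of (C), they are pairwise inequivalent, and none of them is equivalent to a member of a family. Every member of each family is a solution of (C),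 and within each family it is irreducible for all but finitely many $\varphi\in\mathbb Q\cap[0,1)$. -/

import Mathlib

/-- A rational `n`-tuple `φ` is an irreducible solution of `∑ cos 2πφⱼ = 0`: the sum vanishes, and
no sum over a nonempty proper subset of the indices does. -/
def IrreducibleCos {n : ℕ} (φ : Fin n → ℚ) : Prop :=
  ∑ j, Real.cos (2 * Real.pi * (φ j : ℝ)) = 0 ∧
    ∀ E : Finset (Fin n), E.Nonempty → E ≠ Finset.univ →
      ∑ j ∈ E, Real.cos (2 * Real.pi * (φ j : ℝ)) ≠ 0

/-- A rational `n`-tuple `φ` is an irreducible solution of `∑ exp (2πiφⱼ) = 0`. -/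
def IrreducibleExp {n : ℕ} (φ : Fin n → ℚ) : Prop :=
  ∑ j, Complex.exp (2 * Real.pi * Complex.I * (φ j : ℂ)) = 0 ∧
    ∀ E : Finset (Fin n), E.Nonempty → E ≠ Finset.univ →
      ∑ j ∈ E, Complex.exp (2 * Real.pi * Complex.I * (φ j : ℂ)) ≠ 0

/-- Equality of two rational numbers modulo `1`. -/
def EqModOne (x y : ℚ) : Prop := ∃ m : ℤ, x = y + m

/-- Equivalence for the exponential equation: equal up to a permutation, entries modulo `1`. -/
def ExpEquiv {n : ℕ} (φ ψ : Fin n → ℚ) : Prop :=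
  ∃ σ : Equiv.Perm (Fin n), ∀ j, EqModOne (ψ j) (φ (σ j))

/-- Equivalence for the cosine equation: `ψ` arises from `φ` (entries modulo `1`) by a permutation,
possibly the simultaneous change `φⱼ ↦ 1/2 - φⱼ` of all entries, and then changes `φⱼ ↦ 1 - φⱼ` of
any of the entries. This is the equivalence relation generated by these moves: `φⱼ ↦ 1 - φⱼ`
commutes with `φⱼ ↦ 1/2 - φⱼ` up to moves `φⱼ ↦ 1 - φⱼ` and integers. -/
def CosEquiv {n : ℕ} (φ ψ : Fin n → ℚ) : Prop :=
  ∃ σ : Equiv.Perm (Fin n),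
    (∀ j, EqModOne (ψ j) (φ (σ j)) ∨ EqModOne (ψ j) (1 - φ (σ j))) ∨
    (∀ j, EqModOne (ψ j) (1 / 2 - φ (σ j)) ∨ EqModOne (ψ j) (1 - (1 / 2 - φ (σ j))))

/-- The one-parameter families for the exponential equation. -/
def expFamilies : (n : ℕ) → List (ℚ → Fin n → ℚ)
  | 2 => [fun θ => ![θ, θ + 1 / 2]]
  | 3 => [fun θ => ![θ, θ + 1 / 3, θ + 2 / 3]]
  | 5 => [fun θ => ![θ, θ + 1 / 5, θ + 2 / 5, θ + 3 / 5, θ + 4 / 5]]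
  | 6 => [fun θ => ![θ - 1 / 6, θ + 1 / 6, θ + 1 / 5, θ + 2 / 5, θ + 3 / 5, θ + 4 / 5]]
  | _ => []

/-- The one-parameter families for the cosine equation. -/
def cosFamilies : (n : ℕ) → List (ℚ → Fin n → ℚ)
  | 2 => [fun θ => ![θ, 1 / 2 - θ]]
  | 3 => [fun θ => ![θ, θ + 1 / 3, θ - 1 / 3]]
  | 5 => [fun θ => ![θ, θ + 1 / 5, θ + 2 / 5, θ + 3 / 5, θ + 4 / 5]]
  | 6 => [fun θ => ![θ + 1 / 6, θ - 1 / 6, θ + 1 / 5, θ + 2 / 5, θ + 3 / 5, θ + 4 / 5]]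
  | _ => []

/-- The 5-tuples that depend on `L = 1, 2, 3`. -/
def cosFiveL (L : ℚ) : Fin 5 → ℚ :=
  ![L / 7 + 1 / 6, L / 7 - 1 / 6, 2 * L / 7, 3 * L / 7, 1 / 6]

/-- The first series of 6-tuples that depend on `L = 1, 2, 3`. -/
def cosSixL₁ (L : ℚ) : Fin 6 → ℚ :=
  ![L / 7 + 1 / 6, L / 7 - 1 / 6, 2 * L / 7, 3 * L / 7, 0, 1 / 3]

/-- The second series of 6-tuples that depend on `L = 1, 2, 3`. -/
def cosSixL₂ (L : ℚ) : Fin 6 → ℚ :=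
  ![L / 7 + 1 / 6, L / 7 - 1 / 6, 2 * L / 7, 3 * L / 7, 1 / 10, 3 / 10]

/-- The third series of 6-tuples that depend on `L = 1, 2, 3`. -/
def cosSixL₃ (L : ℚ) : Fin 6 → ℚ :=
  ![L / 7 + 1 / 6, L / 7 - 1 / 6, 2 * L / 7 + 1 / 6, 2 * L / 7 - 1 / 6, 3 * L / 7, 1 / 6]

/-- The sporadic solutions of the cosine equation: one triple, 4 quadruples, 7 quintuples and
13 sextuples. -/
def cosSporadic : (n : ℕ) → List (Fin n → ℚ)
  | 3 => [![1 / 10, 3 / 10, 1 / 3]]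
  | 4 => [![0, 1 / 5, 1 / 3, 2 / 5],
          ![1 / 30, 1 / 6, 11 / 30, 2 / 5],
          ![1 / 15, 4 / 15, 3 / 10, 1 / 3],
          ![1 / 7, 2 / 7, 3 / 7, 1 / 6]]
  | 5 => [![0, 1 / 30, 1 / 3, 11 / 30, 2 / 5],
          ![0, 1 / 5, 7 / 30, 1 / 3, 13 / 30],
          cosFiveL 1, cosFiveL 2, cosFiveL 3,
          ![1 / 7, 2 / 7, 3 / 7, 0, 1 / 3],
          ![1 / 7, 2 / 7, 3 / 7, 1 / 10, 3 / 10]]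
  | 6 => [![1 / 11, 2 / 11, 3 / 11, 4 / 11, 5 / 11, 1 / 6],
          cosSixL₁ 1, cosSixL₁ 2, cosSixL₁ 3,
          cosSixL₂ 1, cosSixL₂ 2, cosSixL₂ 3,
          cosSixL₃ 1, cosSixL₃ 2, cosSixL₃ 3,
          ![1 / 7, 2 / 7, 3 / 7, 0, 1 / 5, 2 / 5],
          ![1 / 7, 2 / 7, 3 / 7, 1 / 15, 4 / 15, 3 / 10],
          ![1 / 7, 2 / 7, 3 / 7, 1 / 10, 2 / 15, 7 / 15]]
  | _ => []

/-!
Galois conjugations fixing the `M`-th roots of unity act on a vanishing sum of `pM`-th roots of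
unity, grouped into components by exponents modulo the prime `p`. If `p` divides `M`, every
component vanishes, and irreducibility leaves room for a single one. If `p` does not divide `M`, the
components, freed of their `p`-th roots of unity, all have the same value `α`; when `α ≠ 0` no
component is empty, so the number of terms bounds `p`, and a component with a single term makes `α`
a root of unity. For the exponentials this leaves only the families. A sum of cosines is the sum of
the exponentials of `±φⱼ`. Either some choice of signs makes the sum of the exponentials themselves
vanish, which leads back to the families, or `p ≤ 11` and `α` may be taken to be `1` if `p` is `7`
or `11`. What remains are equations with denominator dividing `60`: `∑ cos = 0`, and `∑ cos = 1/2`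
for `p = 7`.

These are settled by finite searches that replace a root of unity of order `4620` by its residue,
of order `4620`, modulo a prime above `9241 = 2 · 4620 + 1`. The same residues show that no proper
part of a listed tuple has sum zero.
-/

section ZeroSums

variable {ι κ M R : Type*} [Fintype ι] [Fintype κ]

/-- A family whose sum vanishes while no sum over a nonempty proper subset of the indices does. For
the values of the cosine, or of the exponential, of a tuple this is irreducibility. -/
def IsMinimalZeroSum [AddCommMonoid M] (f : ι → M) : Prop :=
  ∑ j, f j = 0 ∧ ∀ E : Finset ι, E.Nonempty → E ≠ Finset.univ → ∑ j ∈ E, f j ≠ 0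

theorem IsMinimalZeroSum.eq_univ [AddCommMonoid M] {f : ι → M} (hf : IsMinimalZeroSum f)
    {E : Finset ι} (hE : E.Nonempty) (hsum : ∑ j ∈ E, f j = 0) : E = Finset.univ :=
  by_contra fun hne => hf.2 E hE hne hsum

theorem IsMinimalZeroSum.const_mul [Semiring R] [NoZeroDivisors R] {f : ι → R}
    (hf : IsMinimalZeroSum f) {r : R} (hr : r ≠ 0) : IsMinimalZeroSum fun j => r * f j := by
  simp only [IsMinimalZeroSum, ← Finset.mul_sum, ne_eq, mul_eq_zero, hr, false_or]
  exact hf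

theorem IsMinimalZeroSum.neg [AddCommGroup M] {f : ι → M} (hf : IsMinimalZeroSum f) :
    IsMinimalZeroSum fun j => -f j := by
  simp only [IsMinimalZeroSum, Finset.sum_neg_distrib, ne_eq, neg_eq_zero]
  exact hf

theorem IsMinimalZeroSum.comp_equiv [AddCommMonoid M] {f : ι → M} (hf : IsMinimalZeroSum f)
    (e : κ ≃ ι) : IsMinimalZeroSum fun j => f (e j) := by
  refine ⟨(Equiv.sum_comp e f).trans hf.1, fun E hE hne hsum => hne ?_⟩
  rw [← Finset.map_inj (f := e.toEmbedding), Finset.map_univ_equiv]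
  exact hf.eq_univ hE.map ((Finset.sum_map E e.toEmbedding f).trans hsum)

end ZeroSums

section ValueMultisets

variable {ι α : Type*}

theorem sum_singleton_eq_map (s : Finset ι) (f : ι → α) :
    ∑ i ∈ s, ({f i} : Multiset α) = s.val.map f := by
  rw [← Multiset.sum_map_singleton (s.val.map f), Multiset.map_map]
  rfl

theorem map_sum_singleton {β : Type*} (s : Finset ι) (f : ι → α) (g : α → β) :
    (∑ i ∈ s, ({f i} : Multiset α)).map g = ∑ i ∈ s, {g (f i)} := by
  simp only [sum_singleton_eq_map, Multiset.map_map, Function.comp_def]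

variable [Fintype ι]

theorem exists_perm_of_sum_singleton_eq {f g : ι → α}
    (h : ∑ i, ({f i} : Multiset α) = ∑ i, {g i}) : ∃ σ : Equiv.Perm ι, ∀ i, f i = g (σ i) := by
  classical
  rw [sum_singleton_eq_map, sum_singleton_eq_map] at h
  have fibers_equiv (c : α) : Nonempty ({i // f i = c} ≃ {i // g i = c}) := by
    have hcount := congrArg (Multiset.count c) h
    rw [Multiset.count_map, Multiset.count_map] at hcount
    refine ⟨Fintype.equivOfCardEq ?_⟩
    rw [Fintype.card_subtype, Fintype.card_subtype]
    simpa [Finset.card_def, Finset.filter_val, eq_comm] using hcount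
  exact ⟨Equiv.ofFiberEquiv fun c => (fibers_equiv c).some,
    fun i => (Equiv.ofFiberEquiv_map _ i).symm⟩

theorem sum_singleton_comp_perm (σ : Equiv.Perm ι) (g : ι → α) :
    ∑ i, ({g (σ i)} : Multiset α) = ∑ i, {g i} :=
  Equiv.sum_comp σ fun i => ({g i} : Multiset α)

theorem IsMinimalZeroSum.of_sum_singleton_eq [AddCommMonoid α] {f g : ι → α}
    (hf : IsMinimalZeroSum f) (h : ∑ i, ({g i} : Multiset α) = ∑ i, {f i}) :
    IsMinimalZeroSum g := by
  obtain ⟨σ, hσ⟩ := exists_perm_of_sum_singleton_eq h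
  exact (funext hσ : g = f ∘ σ) ▸ hf.comp_equiv σ

end ValueMultisets

section ExpCos

/-- The root of unity `exp (2πix)` attached to a rational number. -/
noncomputable def expRat (x : ℚ) : ℂ := Complex.exp (2 * Real.pi * Complex.I * (x : ℂ))

/-- The real number `cos (2πx)` attached to a rational number. -/
noncomputable def cosRat (x : ℚ) : ℝ := Real.cos (2 * Real.pi * (x : ℝ))

theorem expRat_add (x y : ℚ) : expRat (x + y) = expRat x * expRat y := by
  simp only [expRat, ← Complex.exp_add]
  congr 1
  push_cast
  ring

theorem expRat_zero : expRat 0 = 1 := by simp [expRat]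

theorem expRat_ne_zero (x : ℚ) : expRat x ≠ 0 := Complex.exp_ne_zero _

theorem expRat_mul_expRat_neg (x : ℚ) : expRat x * expRat (-x) = 1 := by
  rw [← expRat_add, add_neg_cancel, expRat_zero]

theorem expRat_natCast_mul (k : ℕ) (x : ℚ) : expRat (k * x) = expRat x ^ k := by
  rw [expRat, expRat, ← Complex.exp_nat_mul]
  congr 1
  push_cast
  ring

theorem expRat_eq_iff {x y : ℚ} : expRat x = expRat y ↔ EqModOne x y := by
  rw [expRat, expRat, Complex.exp_eq_exp_iff_exists_int]
  refine exists_congr fun m => ?_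
  rw [show 2 * Real.pi * Complex.I * (y : ℂ) + m * (2 * Real.pi * Complex.I)
      = 2 * Real.pi * Complex.I * ((y + m : ℚ) : ℂ) by push_cast; ring,
    mul_right_inj' Complex.two_pi_I_ne_zero, Rat.cast_inj]

theorem expRat_add_intCast (x : ℚ) (m : ℤ) : expRat (x + m) = expRat x :=
  expRat_eq_iff.2 ⟨m, rfl⟩

theorem expRat_intCast (m : ℤ) : expRat m = 1 := by
  rw [← zero_add (m : ℚ), expRat_add_intCast, expRat_zero]

theorem expRat_half : expRat (1 / 2) = -1 := by
  rw [expRat, ← Complex.exp_pi_mul_I]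
  congr 1
  push_cast
  ring

theorem expRat_add_half (x : ℚ) : expRat (x + 1 / 2) = -expRat x := by
  rw [expRat_add, expRat_half, mul_neg_one]

theorem expRat_eq_exp_ofReal_mul_I (x : ℚ) :
    expRat x = Complex.exp ((2 * Real.pi * (x : ℝ) : ℝ) * Complex.I) := by
  rw [expRat]
  congr 1
  push_cast
  ring

theorem expRat_re (x : ℚ) : (expRat x).re = cosRat x := by
  rw [expRat_eq_exp_ofReal_mul_I, Complex.exp_ofReal_mul_I_re, cosRat]

theorem conj_expRat (x : ℚ) : starRingEnd ℂ (expRat x) = expRat (-x) := by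
  rw [expRat, expRat, ← Complex.exp_conj]
  simp [Complex.conj_ofNat]

theorem expRat_add_expRat_neg (x : ℚ) : expRat x + expRat (-x) = 2 * (cosRat x : ℂ) := by
  rw [← conj_expRat, Complex.add_conj, expRat_re]
  push_cast
  rfl

theorem cosRat_neg (x : ℚ) : cosRat (-x) = cosRat x := by simp [cosRat]

theorem cosRat_add_intCast (x : ℚ) (m : ℤ) : cosRat (x + m) = cosRat x := by
  rw [← expRat_re, expRat_add_intCast, expRat_re]

theorem cosRat_add_half (x : ℚ) : cosRat (x + 1 / 2) = -cosRat x := by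
  rw [← expRat_re, expRat_add_half, Complex.neg_re, expRat_re]

theorem cosRat_half_sub (x : ℚ) : cosRat (1 / 2 - x) = -cosRat x := by
  rw [← cosRat_neg x, ← cosRat_add_half, neg_add_eq_sub]

theorem cosRat_eq_iff {x y : ℚ} : cosRat x = cosRat y ↔ EqModOne x y ∨ EqModOne x (1 - y) := by
  constructor
  · intro h
    obtain ⟨m, hm⟩ := Real.cos_eq_cos_iff.1 h.symm
    have cancel {z : ℚ} (hz : 2 * Real.pi * (x : ℝ) = 2 * Real.pi * (z : ℝ)) : x = z := by
      exact_mod_cast mul_left_cancel₀ Real.two_pi_pos.ne' hz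
    refine hm.imp (fun hm => ⟨m, cancel ?_⟩) (fun hm => ⟨m - 1, cancel ?_⟩)
    all_goals rw [hm]; push_cast; ring
  · rintro (⟨m, rfl⟩ | ⟨m, rfl⟩)
    · rw [cosRat_add_intCast]
    · rw [cosRat_add_intCast, ← cosRat_neg y, ← cosRat_add_intCast (-y) 1]
      congr 1
      push_cast
      ring

end ExpCos

section Denominators

variable {ι : Type*}

theorem den_dvd_iff {x : ℚ} {N : ℕ} : x.den ∣ N ↔ ∃ k : ℤ, x * N = k := by
  constructor
  · rintro ⟨m, rfl⟩
    refine ⟨x.num * m, ?_⟩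
    push_cast
    rw [← mul_assoc, Rat.mul_den_eq_num]
  · rintro ⟨k, hk⟩
    rcases eq_or_ne N 0 with rfl | hN
    · exact dvd_zero _
    · have hx : x = Rat.divInt k N := by
        rw [Rat.divInt_eq_div, ← hk, Int.cast_natCast,
          mul_div_cancel_right₀ x (Nat.cast_ne_zero.2 hN)]
      rw [hx]
      exact_mod_cast Rat.den_dvd k N

theorem den_dvd_of_dvd_numerator {x : ℚ} {p M : ℕ} {k : ℤ} (hp : p ≠ 0)
    (hx : x * (p * M : ℕ) = k) (hk : (p : ℤ) ∣ k) : x.den ∣ M := by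
  obtain ⟨m, rfl⟩ := hk
  refine den_dvd_iff.2 ⟨m, mul_left_cancel₀ (Nat.cast_ne_zero.2 hp : (p : ℚ) ≠ 0) ?_⟩
  push_cast at hx ⊢
  linear_combination hx

/-- The least common denominator of a tuple. -/
def commonDenominator [Fintype ι] (φ : ι → ℚ) : ℕ := Finset.univ.lcm fun j => (φ j).den

theorem commonDenominator_dvd_iff [Fintype ι] {φ : ι → ℚ} {N : ℕ} :
    commonDenominator φ ∣ N ↔ ∀ j, (φ j).den ∣ N := by
  simp [commonDenominator, Finset.lcm_dvd_iff]

theorem commonDenominator_ne_zero [Fintype ι] (φ : ι → ℚ) : commonDenominator φ ≠ 0 := by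
  simp [commonDenominator, Finset.lcm_eq_zero_iff]

theorem den_dvd_commonDenominator [Fintype ι] (φ : ι → ℚ) (j : ι) :
    (φ j).den ∣ commonDenominator φ :=
  commonDenominator_dvd_iff.1 dvd_rfl j

theorem exists_not_den_dvd [Fintype ι] {φ : ι → ℚ} {p M : ℕ} (hp : 1 < p)
    (h : commonDenominator φ = p * M) : ∃ j, ¬ (φ j).den ∣ M := by
  have hM : 0 < M := Nat.pos_of_ne_zero (right_ne_zero_of_mul (h ▸ commonDenominator_ne_zero φ))
  rw [← not_forall, ← commonDenominator_dvd_iff, h]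
  exact Nat.not_dvd_of_pos_of_lt hM (lt_mul_of_one_lt_left hM hp)

theorem exists_eq_div_add {p M : ℕ} (hp : p ≠ 0) (hM : M ≠ 0) (h : p.Coprime M) {x : ℚ}
    (hx : x.den ∣ p * M) : ∃ (a : ℤ) (b : ℚ), x = a / p + b ∧ b.den ∣ M := by
  obtain ⟨k, hk⟩ := den_dvd_iff.1 hx
  have bezout : (1 : ℚ) = p * (p.gcdA M : ℤ) + M * (p.gcdB M : ℤ) := by
    exact_mod_cast (by rw [← Nat.gcd_eq_gcd_ab, h]; rfl : (1 : ℤ) = p * p.gcdA M + M * p.gcdB M)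
  refine ⟨k * p.gcdB M, k * p.gcdA M / M, ?_, den_dvd_iff.2 ⟨k * p.gcdA M, ?_⟩⟩
  · push_cast at hk ⊢
    field_simp
    rw [← hk]
    linear_combination x * p * M * bezout
  · push_cast
    field_simp

end Denominators

section GaloisConjugation

open Polynomial

variable {ι : Type*}

/-- A primitive root of unity in characteristic zero is a generic root of the cyclotomic
polynomial. -/
theorem sum_pow_eq_zero {K R : Type*} [Field K] [CharZero K] [CommRing R] {N : ℕ} (hN : N ≠ 0)
    {ζ : K} (hζ : IsPrimitiveRoot ζ N) {g : R} (hg : (cyclotomic N R).IsRoot g) {s : Finset ι}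
    {k : ι → ℕ} (h : ∑ i ∈ s, ζ ^ k i = 0) : ∑ i ∈ s, g ^ k i = 0 := by
  have hζ_aeval : aeval ζ (∑ i ∈ s, X ^ k i : ℤ[X]) = 0 := by simpa using h
  have hdvd : cyclotomic N ℤ ∣ ∑ i ∈ s, X ^ k i := by
    rw [cyclotomic_eq_minpoly hζ (Nat.pos_of_ne_zero hN)]
    exact minpoly.isIntegrallyClosed_dvd (hζ.isIntegral (Nat.pos_of_ne_zero hN)) hζ_aeval
  obtain ⟨Q, hQ⟩ := hdvd
  have hg_aeval : aeval g (cyclotomic N ℤ) = 0 := by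
    rw [← hg.eq_zero, ← map_cyclotomic_int N R, eval_map, aeval_def]
    rfl
  simpa [hg_aeval] using congrArg (aeval g) hQ

theorem isPrimitiveRoot_expRat {N t : ℕ} (hN : N ≠ 0) (ht : t.Coprime N) :
    IsPrimitiveRoot (expRat (t / N)) N := by
  convert Complex.isPrimitiveRoot_exp_of_coprime t N hN ht using 1
  rw [expRat]
  congr 1
  push_cast
  ring

theorem expRat_mul_div (t k N : ℕ) : expRat (t * (k / N)) = expRat (t / N) ^ k := by
  rw [← expRat_natCast_mul]
  congr 1
  ring

theorem exists_eqModOne_div {N : ℕ} (hN : N ≠ 0) {x : ℚ} (hx : x.den ∣ N) :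
    ∃ k : ℕ, EqModOne x (k / N) := by
  obtain ⟨a, ha⟩ := den_dvd_iff.1 hx
  have hN' : (N : ℤ) ≠ 0 := by exact_mod_cast hN
  have hemod : ((a % N).toNat : ℚ) = (a - N * (a / N : ℤ) : ℤ) := by
    rw [← Int.emod_def]
    exact_mod_cast Int.toNat_of_nonneg (Int.emod_nonneg a hN')
  refine ⟨(a % N).toNat, a / N, ?_⟩
  rw [hemod]
  push_cast
  rw [← ha]
  field_simp
  ring

theorem sum_expRat_mul_eq_zero {s : Finset ι} {N t : ℕ} (hN : N ≠ 0) {x : ι → ℚ}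
    (hx : ∀ i, (x i).den ∣ N) (h : ∑ i ∈ s, expRat (x i) = 0) (ht : t.Coprime N) :
    ∑ i ∈ s, expRat (t * x i) = 0 := by
  choose k hk using fun i => exists_eqModOne_div hN (hx i)
  have hpow (i : ι) (u : ℕ) : expRat (u * x i) = expRat (u / N) ^ k i := by
    rw [← expRat_mul_div, expRat_natCast_mul, expRat_natCast_mul, expRat_eq_iff.2 (hk i)]
  have hone := isPrimitiveRoot_expRat hN (Nat.coprime_one_left N)
  have ht := (isPrimitiveRoot_expRat hN ht).isRoot_cyclotomic (Nat.pos_of_ne_zero hN)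
  simp only [hpow]
  refine sum_pow_eq_zero hN hone ht ?_
  rw [← h]
  refine Finset.sum_congr rfl fun i _ => ?_
  rw [← hpow, Nat.cast_one, one_mul]

end GaloisConjugation

section Components

open ZMod

variable {ι : Type*}

theorem expRat_div_eq_stdAddChar {p : ℕ} [NeZero p] (a : ℤ) :
    expRat (a / p) = stdAddChar (a : ZMod p) := by
  rw [stdAddChar_coe, expRat]
  congr 1
  push_cast
  ring

theorem card_mul_sum_filter_eq {p : ℕ} [NeZero p] (s : Finset ι) (a : ι → ZMod p) (f : ι → ℂ)
    (c : ZMod p) : (p : ℂ) * ∑ i ∈ s with a i = c, f i =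
      ∑ j : ZMod p, stdAddChar (-(j * c)) * ∑ i ∈ s, stdAddChar (j * a i) * f i := by
  have hchar (i : ι) (j : ZMod p) : stdAddChar (-(j * c)) * (stdAddChar (j * a i) * f i)
      = stdAddChar (j * (a i - c)) * f i := by
    rw [← mul_assoc, ← AddChar.map_add_eq_mul, mul_sub, sub_eq_neg_add]
  simp only [Finset.mul_sum, hchar]
  rw [Finset.sum_comm, Finset.sum_filter]
  refine Finset.sum_congr rfl fun i _ => ?_
  rw [← Finset.sum_mul, AddChar.sum_mulShift _ (isPrimitive_stdAddChar p), ZMod.card]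
  simp only [sub_eq_zero]
  split_ifs <;> simp

/-- When all prime factors of `p` divide `M`, the conjugations fixing the `M`-th roots of unity
multiply a `pM`-th root of unity by arbitrary powers of a `p`-th root of unity that depends only on
its exponent modulo `p`. -/
theorem sum_filter_expRat_eq_zero {s : Finset ι} {p M e : ℕ} [NeZero p] (hM : M ≠ 0)
    (hpM : p ∣ M ^ e) {x : ι → ℚ} {k : ι → ℤ} (hx : ∀ i, x i * (p * M : ℕ) = k i)
    (h : ∑ i ∈ s, expRat (x i) = 0) (c : ZMod p) :
    ∑ i ∈ s with (k i : ZMod p) = c, expRat (x i) = 0 := by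
  have hp : p ≠ 0 := NeZero.ne p
  have coprime (j : ℕ) : (1 + j * M).Coprime (p * M) := by
    have hjM : (1 + j * M).Coprime M := by simp
    exact ((hjM.pow_right e).coprime_dvd_right hpM).mul_right hjM
  have conjugate (j : ZMod p) : ∑ i ∈ s, stdAddChar (j * (k i : ZMod p)) * expRat (x i) = 0 := by
    rw [← sum_expRat_mul_eq_zero (mul_ne_zero hp hM) (fun i => den_dvd_iff.2 ⟨k i, hx i⟩) h
      (coprime j.val)]
    refine Finset.sum_congr rfl fun i _ => ?_
    have hjk : stdAddChar (j * (k i : ZMod p)) = expRat ((j.val * k i : ℤ) / p) := by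
      rw [expRat_div_eq_stdAddChar]
      simp
    rw [hjk, ← expRat_add]
    congr 1
    push_cast [← hx i]
    field_simp
    ring
  have hsum := card_mul_sum_filter_eq s (fun i => (k i : ZMod p)) (fun i => expRat (x i)) c
  simp only [conjugate, mul_zero, Finset.sum_const_zero, mul_eq_zero] at hsum
  exact hsum.resolve_left (Nat.cast_ne_zero.2 hp)

theorem expRat_natCast_mul_of_modEq {M t : ℕ} {x : ℚ} (hx : x.den ∣ M) (ht : t ≡ 1 [MOD M]) :
    expRat (t * x) = expRat x := by
  obtain ⟨k, hk⟩ := den_dvd_iff.1 hx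
  obtain ⟨v, hv⟩ := Nat.modEq_iff_dvd.1 ht.symm
  have hv' : (t : ℚ) = 1 + M * v := by
    rw [← sub_eq_iff_eq_add']
    exact_mod_cast hv
  refine expRat_eq_iff.2 ⟨v * k, ?_⟩
  rw [hv']
  push_cast
  rw [← hk]
  ring

theorem sum_stdAddChar_mul_eq_zero {s : Finset ι} {p M : ℕ} [Fact p.Prime] (hM : M ≠ 0)
    (hpM : p.Coprime M) {a : ι → ℤ} {b : ι → ℚ} (hb : ∀ i, (b i).den ∣ M)
    (h : ∑ i ∈ s, expRat (a i / p + b i) = 0) {j : ZMod p} (hj : j ≠ 0) :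
    ∑ i ∈ s, stdAddChar (j * (a i : ZMod p)) * expRat (b i) = 0 := by
  have hp : p ≠ 0 := NeZero.ne p
  obtain ⟨t, htj, htM⟩ := Nat.chineseRemainder hpM j.val 1
  have htj : (t : ZMod p) = j := by
    rw [(ZMod.natCast_eq_natCast_iff _ _ _).2 htj, ZMod.natCast_zmod_val]
  have ht : t.Coprime (p * M) := by
    refine Nat.Coprime.mul_right ?_ (by rw [Nat.Coprime, htM.gcd_eq, Nat.gcd_one_left])
    rw [← ZMod.isUnit_iff_coprime, htj]
    exact hj.isUnit
  have hden (i : ι) : (a i / p + b i).den ∣ p * M := by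
    obtain ⟨k, hk⟩ := den_dvd_iff.1 (hb i)
    refine den_dvd_iff.2 ⟨a i * M + p * k, ?_⟩
    push_cast
    rw [← hk]
    field_simp
  rw [← sum_expRat_mul_eq_zero (mul_ne_zero hp hM) hden h ht]
  refine Finset.sum_congr rfl fun i _ => ?_
  have hja : stdAddChar (j * (a i : ZMod p)) = expRat ((t * a i : ℤ) / p) := by
    rw [expRat_div_eq_stdAddChar, ← htj]
    simp
  rw [mul_add, expRat_add, expRat_natCast_mul_of_modEq (hb i) htM, hja]
  congr 2
  push_cast
  ring

/-- For `p ∤ M` the `p`-th roots of unity satisfy no linear relation over the `M`-th roots of unity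
other than the multiples of the vanishing of their sum. -/
theorem mul_sum_filter_expRat_eq {s : Finset ι} {p M : ℕ} [Fact p.Prime] (hM : M ≠ 0)
    (hpM : p.Coprime M) {a : ι → ℤ} {b : ι → ℚ} (hb : ∀ i, (b i).den ∣ M)
    (h : ∑ i ∈ s, expRat (a i / p + b i) = 0) (c : ZMod p) :
    (p : ℂ) * ∑ i ∈ s with (a i : ZMod p) = c, expRat (b i) = ∑ i ∈ s, expRat (b i) := by
  rw [card_mul_sum_filter_eq, Finset.sum_eq_single_of_mem 0 (Finset.mem_univ 0) fun j _ hj => by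
    rw [sum_stdAddChar_mul_eq_zero hM hpM hb h hj, mul_zero]]
  simp

end Components

section ResidueField

variable {ι : Type*}

theorem isPrimitiveRoot_zmod_9241 : IsPrimitiveRoot (169 : ZMod 9241) 4620 := by
  have pow_eq_one (n : ℕ) : (169 : ZMod 9241) ^ n = 1 ↔ 169 ^ n % 9241 = 1 := by
    simpa using ZMod.natCast_eq_natCast_iff' (169 ^ n) 1 9241
  have primeFactors : Nat.primeFactors 4620 = {2, 3, 5, 7, 11} := by
    decide +kernel
  have order : orderOf (169 : ZMod 9241) = 4620 := by
    refine orderOf_eq_of_pow_and_pow_div_prime (by norm_num)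
      ((pow_eq_one _).2 (by decide +kernel)) fun p hp hdvd => ?_
    have hmem := Nat.mem_primeFactors.2 ⟨hp, hdvd, by norm_num⟩
    rw [primeFactors] at hmem
    rw [Ne, pow_eq_one]
    fin_cases hmem <;> decide +kernel
  exact order ▸ IsPrimitiveRoot.orderOf _

/-- The residue of `exp (2πi k/4620)` modulo a prime above `9241 = 2 · 4620 + 1` at which this root
of unity is congruent to `169`. -/
def expResidue (k : ℕ) : ℕ := 169 ^ k % 9241

/-- The residue of `2 cos (2π k/4620)` modulo the same prime; `3937` is the inverse of `169`. -/
def cosResidue (k : ℕ) : ℕ := (169 ^ k + 3937 ^ k) % 9241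

theorem sum_expResidue_mod {s : Finset ι} {k : ι → ℕ} (h : ∑ i ∈ s, expRat (k i / 4620) = 0) :
    (∑ i ∈ s, expResidue (k i)) % 9241 = 0 := by
  have : Fact (Nat.Prime 9241) := ⟨by norm_num⟩
  have hζ := isPrimitiveRoot_expRat (N := 4620) (by norm_num) (Nat.coprime_one_left _)
  have hpow : ∑ i ∈ s, expRat ((1 : ℕ) / (4620 : ℕ)) ^ k i = 0 := by
    rw [← h]
    refine Finset.sum_congr rfl fun i _ => ?_
    rw [← expRat_mul_div, Nat.cast_one, one_mul]
    rfl
  have hres := sum_pow_eq_zero (by norm_num) hζ (isPrimitiveRoot_zmod_9241.isRoot_cyclotomic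
    (by norm_num)) hpow
  rw [← Nat.dvd_iff_mod_eq_zero, ← ZMod.natCast_eq_zero_iff, ← hres, Nat.cast_sum]
  refine Finset.sum_congr rfl fun i _ => ?_
  rw [expResidue, ZMod.natCast_mod, Nat.cast_pow]
  rfl

theorem sum_cosResidue_mod {s : Finset ι} {k : ι → ℕ} (h : ∑ i ∈ s, cosRat (k i / 4620) = 0) :
    (∑ i ∈ s, cosResidue (k i)) % 9241 = 0 := by
  have neg_angle (i : ι) : expRat ((4619 * k i : ℕ) / 4620) = expRat (-(k i / 4620)) :=
    expRat_eq_iff.2 ⟨k i, by push_cast; ring⟩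
  have hexp : ∑ i ∈ s.disjSum s, expRat ((Sum.elim k (4619 * k ·) i : ℕ) / 4620) = 0 := by
    simp only [Finset.sum_disjSum, Sum.elim_inl, Sum.elim_inr, neg_angle,
      ← Finset.sum_add_distrib, expRat_add_expRat_neg, ← Finset.mul_sum, ← Complex.ofReal_sum, h,
      Complex.ofReal_zero, mul_zero]
  have hres := sum_expResidue_mod hexp
  rw [Finset.sum_disjSum, ← Finset.sum_add_distrib, Finset.sum_nat_mod] at hres
  rw [Finset.sum_nat_mod, ← hres]
  congr 1
  refine Finset.sum_congr rfl fun i _ => ?_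
  have inverse : 3937 ≡ 169 ^ 4619 [MOD 9241] := by decide +kernel
  rw [Sum.elim_inl, Sum.elim_inr, expResidue, expResidue, ← Nat.add_mod, cosResidue, Nat.mod_mod,
    pow_mul]
  exact (inverse.pow _).add_left _

end ResidueField

section Search

/-- Whether `good` holds for every list that extends `acc` by a multiset of `n` elements of `keys`
whose sum of residues `r`, increased by `s`, vanishes modulo `q`. -/
def checkSums (q : ℕ) (r : ℕ → ℕ) (good : List ℕ → Bool) : ℕ → List ℕ → ℕ → List ℕ → Bool
  | 0, _, s, acc => !(Nat.beq (s % q) 0) || good acc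
  | n + 1, keys, s, acc => keys.tails.all fun t => match t with
    | [] => true
    | x :: t => checkSums q r good n (x :: t) ((s + r x) % q) (x :: acc)

theorem exists_good_of_checkSums {q : ℕ} {r : ℕ → ℕ} {good : List ℕ → Bool} {n : ℕ}
    {keys : List ℕ} {s : ℕ} {acc : List ℕ} (hcheck : checkSums q r good n keys s acc = true)
    {m : Multiset ℕ} (hcard : m.card = n) (hmem : ∀ x ∈ m, x ∈ keys)
    (hsum : (s + (m.map r).sum) % q = 0) :
    ∃ l : List ℕ, (l : Multiset ℕ) = m + acc ∧ good l = true := by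
  induction n generalizing keys s acc m with
  | zero =>
    obtain rfl := Multiset.card_eq_zero.1 hcard
    refine ⟨acc, (zero_add _).symm, ?_⟩
    rw [Multiset.map_zero, Multiset.sum_zero, add_zero] at hsum
    simpa [checkSums, hsum] using hcheck
  | succ n ih =>
    induction keys with
    | nil =>
      obtain ⟨x, hx⟩ := Multiset.card_pos_iff_exists_mem.1 (by omega : 0 < m.card)
      simpa using hmem x hx
    | cons x keys ih_keys =>
      rw [checkSums, List.tails_cons, List.all_cons, Bool.and_eq_true] at hcheck
      by_cases hx : x ∈ m
      · obtain ⟨m, rfl⟩ := Multiset.exists_cons_of_mem hx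
        have hsum' : ((s + r x) % q + (m.map r).sum) % q = 0 := by
          rwa [Nat.mod_add_mod, add_assoc, ← Multiset.sum_cons, ← Multiset.map_cons]
        obtain ⟨l, hl, hgood⟩ := ih hcheck.1 (by simpa using hcard)
          (fun y hy => hmem y (Multiset.mem_cons_of_mem hy)) hsum'
        refine ⟨l, ?_, hgood⟩
        rw [hl, ← Multiset.cons_coe, Multiset.add_cons, Multiset.cons_add]
      · refine ih_keys hcheck.2 fun y hy => ?_
        exact (List.mem_cons.1 (hmem y hy)).resolve_left fun h => hx (h ▸ hy)

/-- Whether the list `b` is contained in the list `l`, multiplicities counted. -/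
def isSubmultiset (b l : List ℕ) : Bool := b.all fun x => Nat.ble (b.count x) (l.count x)

theorem coe_le_of_isSubmultiset {b l : List ℕ} (h : isSubmultiset b l = true) :
    (b : Multiset ℕ) ≤ (l : Multiset ℕ) := by
  rw [Multiset.le_iff_count]
  intro x
  simp only [isSubmultiset, List.all_eq_true, Nat.ble_eq] at h
  by_cases hx : x ∈ b
  · simpa using h x hx
  · simp [List.count_eq_zero_of_not_mem hx]

end Search

section Equivalence

variable {n : ℕ} {φ φ' ψ : Fin n → ℚ}

theorem irreducibleCos_iff : IrreducibleCos φ ↔ IsMinimalZeroSum fun j => cosRat (φ j) := Iff.rfl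

theorem irreducibleExp_iff : IrreducibleExp φ ↔ IsMinimalZeroSum fun j => expRat (φ j) := Iff.rfl

/-- The multiset of the values `cos (2πφⱼ)`; it determines the entries of `φ` modulo `1`, up to sign
and order. -/
noncomputable def cosMultiset (φ : Fin n → ℚ) : Multiset ℝ := ∑ j, {cosRat (φ j)}

/-- The multiset of the values `exp (2πiφⱼ)`; it determines the entries of `φ` modulo `1`, up to
order. -/
noncomputable def expMultiset (φ : Fin n → ℚ) : Multiset ℂ := ∑ j, {expRat (φ j)}

theorem sum_cosMultiset (φ : Fin n → ℚ) : (cosMultiset φ).sum = ∑ j, cosRat (φ j) := by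
  rw [cosMultiset, sum_singleton_eq_map]
  rfl

theorem cosMultiset_half_sub (φ : Fin n → ℚ) :
    cosMultiset (fun j => 1 / 2 - φ j) = (cosMultiset φ).map (-·) := by
  simp only [cosMultiset, map_sum_singleton, cosRat_half_sub]

theorem map_re_expMultiset (φ : Fin n → ℚ) : (expMultiset φ).map Complex.re = cosMultiset φ := by
  simp only [cosMultiset, expMultiset, map_sum_singleton, expRat_re]

theorem expEquiv_iff : ExpEquiv φ ψ ↔ expMultiset ψ = expMultiset φ := by
  simp only [ExpEquiv, ← expRat_eq_iff]
  refine ⟨fun ⟨σ, h⟩ => ?_, exists_perm_of_sum_singleton_eq⟩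
  simp only [expMultiset, h]
  exact sum_singleton_comp_perm σ fun j => expRat (φ j)

theorem cosEquiv_iff :
    CosEquiv φ ψ ↔ cosMultiset ψ = cosMultiset φ ∨ cosMultiset ψ = (cosMultiset φ).map (-·) := by
  have perm_iff (χ : Fin n → ℚ) :
      (∃ σ : Equiv.Perm (Fin n), ∀ j, cosRat (ψ j) = cosRat (χ (σ j))) ↔
        cosMultiset ψ = cosMultiset χ := by
    refine ⟨fun ⟨σ, h⟩ => ?_, exists_perm_of_sum_singleton_eq⟩
    simp only [cosMultiset, h]
    exact sum_singleton_comp_perm σ fun j => cosRat (χ j)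
  simp only [CosEquiv, ← cosRat_eq_iff, exists_or]
  exact or_congr (perm_iff φ) ((perm_iff fun j => 1 / 2 - φ j).trans (by rw [cosMultiset_half_sub]))

theorem CosEquiv.congr (h : CosEquiv ψ φ') (hφ : ∀ j, cosRat (φ' j) = cosRat (φ j)) :
    CosEquiv ψ φ := by
  have heq : cosMultiset φ' = cosMultiset φ := by simp only [cosMultiset, hφ]
  exact cosEquiv_iff.2 (heq ▸ cosEquiv_iff.1 h)

theorem CosEquiv.half_sub (h : CosEquiv ψ φ) : CosEquiv ψ fun j => 1 / 2 - φ j := by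
  rw [cosEquiv_iff, cosMultiset_half_sub] at *
  exact h.symm.imp (fun h => by rw [h, Multiset.map_map]; simp) fun h => by rw [h]

/-- The tuple is, up to equivalence, sporadic or a member of a family. -/
def IsListedCos (φ : Fin n → ℚ) : Prop :=
  (∃ ψ ∈ cosSporadic n, CosEquiv ψ φ) ∨ ∃ F ∈ cosFamilies n, ∃ θ : ℚ, CosEquiv (F θ) φ

/-- The tuple is, up to equivalence, a member of a family. -/
def IsListedExp (φ : Fin n → ℚ) : Prop := ∃ F ∈ expFamilies n, ∃ θ : ℚ, ExpEquiv (F θ) φ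

theorem IsListedCos.imp (h : IsListedCos φ) (hφ : ∀ ψ, CosEquiv ψ φ → CosEquiv ψ φ') :
    IsListedCos φ' :=
  Or.imp (fun ⟨ψ, hψ, h⟩ => ⟨ψ, hψ, hφ _ h⟩) (fun ⟨F, hF, θ, h⟩ => ⟨F, hF, θ, hφ _ h⟩) h

theorem IsListedCos.congr (h : IsListedCos φ') (hφ : ∀ j, cosRat (φ' j) = cosRat (φ j)) :
    IsListedCos φ :=
  h.imp fun _ hψ => hψ.congr hφ

theorem IsListedCos.of_neg (h : IsListedCos φ') (hφ : ∀ j, cosRat (φ' j) = -cosRat (φ j)) :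
    IsListedCos φ :=
  h.imp fun _ hψ => hψ.half_sub.congr fun j => by rw [cosRat_half_sub, hφ, neg_neg]

theorem map_cosMultiset_cosFamilies : ∀ n : ℕ,
    (cosFamilies n).map (fun G θ => cosMultiset (G θ)) =
      (expFamilies n).map fun F θ => cosMultiset (F θ)
  | 0 | 1 | 4 | _ + 7 => rfl
  | 2 => congrArg (fun m => [m]) <| funext fun θ => by
    have reflect : cosRat (1 / 2 - θ) = cosRat (θ + 1 / 2) := by
      rw [cosRat_half_sub, cosRat_add_half]
    simp only [cosMultiset, Fin.sum_univ_two, Matrix.cons_val_zero, Matrix.cons_val_one, reflect]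
  | 3 => congrArg (fun m => [m]) <| funext fun θ => by
    have shift : cosRat (θ - 1 / 3) = cosRat (θ + 2 / 3) := by
      rw [← cosRat_add_intCast (θ - 1 / 3) 1]
      congr 1
      push_cast
      ring
    simp only [cosMultiset, Fin.sum_univ_three, Matrix.cons_val, shift]
  | 5 => rfl
  | 6 => congrArg (fun m => [m]) <| funext fun θ => by
    simp only [cosMultiset, Fin.sum_univ_succ]
    exact add_left_comm _ _ _

theorem IsListedExp.isListedCos (h : IsListedExp φ) : IsListedCos φ := by
  obtain ⟨F, hF, θ, hφ⟩ := h
  have hmem := List.mem_map_of_mem (f := fun F θ => cosMultiset (F θ)) hF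
  rw [← map_cosMultiset_cosFamilies] at hmem
  obtain ⟨G, hG, hGF⟩ := List.mem_map.1 hmem
  refine Or.inr ⟨G, hG, θ, cosEquiv_iff.2 (Or.inl ?_)⟩
  rw [← map_re_expMultiset φ, expEquiv_iff.1 hφ, map_re_expMultiset]
  exact (congrFun hGF θ).symm

end Equivalence

section CosineValues

theorem sum_range_expRat_add_div {p : ℕ} (hp : 1 < p) (θ : ℚ) :
    ∑ j ∈ Finset.range p, expRat (θ + j / p) = 0 := by
  have hζ := isPrimitiveRoot_expRat (by omega) (Nat.coprime_one_left p)
  rw [← mul_zero (expRat θ), ← hζ.geom_sum_eq_zero hp, Finset.mul_sum]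
  refine Finset.sum_congr rfl fun j _ => ?_
  rw [expRat_add, ← expRat_mul_div, Nat.cast_one, one_mul]

theorem sum_range_cosRat_add_div {p : ℕ} (hp : 1 < p) (θ : ℚ) :
    ∑ j ∈ Finset.range p, cosRat (θ + j / p) = 0 := by
  simp only [← expRat_re, ← Complex.re_sum, sum_range_expRat_add_div hp, Complex.zero_re]

theorem cosRat_one_sub (x : ℚ) : cosRat (1 - x) = cosRat x :=
  cosRat_eq_iff.2 (Or.inr ⟨0, by simp⟩)

theorem cosRat_zero : cosRat 0 = 1 := by simp [cosRat]

theorem cosRat_quarter : cosRat (1 / 4) = 0 := by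
  have h := cosRat_half_sub (1 / 4)
  norm_num1 at h
  linarith

theorem cosRat_third : cosRat (1 / 3) = -1 / 2 := by
  have hsum := sum_range_cosRat_add_div (p := 3) (by norm_num) 0
  have fold := cosRat_one_sub (1 / 3)
  norm_num [Finset.sum_range_succ, cosRat_zero] at hsum fold ⊢
  linarith

theorem cosRat_sixth : cosRat (1 / 6) = 1 / 2 := by
  have h := cosRat_half_sub (1 / 3)
  rw [cosRat_third] at h
  norm_num1 at h ⊢
  exact h

theorem cosRat_fifth_add : cosRat (1 / 5) + cosRat (2 / 5) = -1 / 2 := by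
  have hsum := sum_range_cosRat_add_div (p := 5) (by norm_num) 0
  have fold₁ := cosRat_one_sub (1 / 5)
  have fold₂ := cosRat_one_sub (2 / 5)
  norm_num [Finset.sum_range_succ, cosRat_zero] at hsum fold₁ fold₂ ⊢
  linarith

theorem cosRat_tenth_add : cosRat (1 / 10) + cosRat (3 / 10) = 1 / 2 := by
  have h₁ := cosRat_half_sub (1 / 5)
  have h₂ := cosRat_half_sub (2 / 5)
  have h := cosRat_fifth_add
  norm_num1 at h₁ h₂ h ⊢
  linarith

end CosineValues

section Folding

/-- The distance from `x` to the nearest integer: the representative in `[0, 1/2]` of `x` modulo `1`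
and up to sign. -/
def foldRat (x : ℚ) : ℚ := |x - round x|

theorem cosRat_foldRat (x : ℚ) : cosRat (foldRat x) = cosRat x := by
  have h : cosRat (x - round x) = cosRat x := by
    simpa using (cosRat_add_intCast (x - round x) (round x)).symm
  rw [foldRat]
  rcases abs_choice (x - round x) with habs | habs <;> rw [habs]
  · exact h
  · rw [cosRat_neg, h]

theorem exists_eq_add_mul_or_neg_add_mul {N : ℕ} (hN : N ≠ 0) (K : ℤ) :
    ∃ (k : ℕ) (m : ℤ), 2 * k ≤ N ∧ (K = k + N * m ∨ K = -k + N * m) := by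
  have : NeZero N := ⟨hN⟩
  obtain ⟨m, hm⟩ : (N : ℤ) ∣ K - (K : ZMod N).valMinAbs := by
    rw [← ZMod.intCast_zmod_eq_zero_iff_dvd, Int.cast_sub, ZMod.coe_valMinAbs, sub_self]
  refine ⟨(K : ZMod N).valMinAbs.natAbs, m, ?_, ?_⟩
  · have := ZMod.natAbs_valMinAbs_le (K : ZMod N)
    omega
  · omega

/-- Whether one of the tuples in `L` has the entries `x`, up to order, modulo `1` and up to sign. -/
def matchesSome {n : ℕ} (L : List (Fin n → ℚ)) (x : List ℚ) : Bool :=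
  L.any fun ψ => ((List.ofFn ψ).map foldRat).isPerm (x.map foldRat)

theorem exists_of_matchesSome {n : ℕ} {L : List (Fin n → ℚ)} {x : List ℚ}
    (h : matchesSome L x = true) : ∃ ψ ∈ L, cosMultiset ψ = x.map cosRat := by
  obtain ⟨ψ, hψ, hperm⟩ := List.any_eq_true.1 h
  refine ⟨ψ, hψ, ?_⟩
  have hcos := Multiset.coe_eq_coe.2 ((List.isPerm_iff.1 hperm).map cosRat)
  simp only [List.map_map, Function.comp_def, cosRat_foldRat] at hcos
  rw [← hcos, List.map_ofFn, cosMultiset, sum_singleton_eq_map, Fin.univ_val_map]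
  rfl

end Folding

section SixtySearch

/-- Numerators over `60` of irreducible solutions of the cosine equation with at most 3 terms. -/
def shortSolutions : List (List ℕ) :=
  [15] :: [6, 18, 20] :: [24, 12, 10] :: ((List.range 16).map fun k => [k, 30 - k]) ++
    (List.range 11).map fun k => [k, 20 - k, 20 + k]

theorem sum_shortSolutions {b : List ℕ} (hb : b ∈ shortSolutions) :
    (b.map fun k : ℕ => cosRat (k / 60)).sum = 0 := by
  simp only [shortSolutions, List.mem_cons, List.mem_append, List.mem_map, List.mem_range,
    List.cons_append] at hb
  rcases hb with rfl | rfl | rfl | ⟨k, hk, rfl⟩ | ⟨k, hk, rfl⟩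
  · have h := cosRat_quarter
    norm_num at h ⊢
    exact h
  · have h₁ := cosRat_tenth_add
    have h₂ := cosRat_third
    norm_num at h₁ h₂ ⊢
    linarith
  · have h₁ := cosRat_fifth_add
    have h₂ := cosRat_sixth
    norm_num at h₁ h₂ ⊢
    linarith
  · have reflect : ((30 - k : ℕ) : ℚ) / 60 = 1 / 2 - k / 60 := by
      rw [Nat.cast_sub (by omega)]
      ring
    simp [reflect, cosRat_half_sub, -one_div]
  · have hsum := sum_range_cosRat_add_div (p := 3) (by norm_num) (k / 60)
    have fold : cosRat ((20 - k : ℕ) / 60) = cosRat (k / 60 + 2 / 3) := by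
      rw [Nat.cast_sub (by omega)]
      exact cosRat_eq_iff.2 (Or.inr ⟨0, by push_cast; ring⟩)
    have shift : ((20 + k : ℕ) : ℚ) / 60 = k / 60 + 1 / 3 := by
      push_cast
      ring
    simp only [Finset.sum_range_succ] at hsum
    simp only [List.map_cons, List.map_nil, List.sum_cons, List.sum_nil, fold, shift]
    norm_num at hsum ⊢
    linarith

variable {ι : Type*}

/-- The residue of `2 cos (2πk/60)`. -/
def sixtyResidue (k : ℕ) : ℕ := cosResidue (77 * k)

theorem sum_map_sixtyResidue_mod {m : Multiset ℕ}
    (h : (m.map fun k : ℕ => cosRat (k / 60)).sum = 0) : (m.map sixtyResidue).sum % 9241 = 0 := by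
  induction m using Quotient.inductionOn with | _ l
  have hsum : ∑ i : Fin l.length, cosRat ((77 * l[i] : ℕ) / 4620) = 0 := by
    rw [← h, Multiset.quot_mk_to_coe, Multiset.map_coe, Multiset.sum_coe,
      ← Fin.sum_univ_fun_getElem]
    refine Finset.sum_congr rfl fun i _ => ?_
    rw [Fin.getElem_fin]
    congr 1
    push_cast
    ring
  rw [Multiset.quot_mk_to_coe, Multiset.map_coe, Multiset.sum_coe, ← Fin.sum_univ_fun_getElem]
  exact sum_cosResidue_mod hsum

theorem exists_good_of_sum_cosRat_eq_zero {good : List ℕ → Bool} {n : ℕ} {keys : List ℕ}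
    {s : Multiset ℕ}
    (hcheck : checkSums 9241 sixtyResidue good n keys (s.map sixtyResidue).sum [] = true)
    {m : Multiset ℕ} (hcard : m.card = n) (hmem : ∀ x ∈ m, x ∈ keys)
    (hsum : ((s + m).map fun k : ℕ => cosRat (k / 60)).sum = 0) :
    ∃ l : List ℕ, (l : Multiset ℕ) = m ∧ good l = true := by
  have hres := sum_map_sixtyResidue_mod hsum
  rw [Multiset.map_add, Multiset.sum_add] at hres
  simpa using exists_good_of_checkSums hcheck hcard hmem hres

theorem exists_finset_of_le_sum_singleton {α : Type*} {s : Finset ι} {f : ι → α} {b : Multiset α}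
    (h : b ≤ ∑ i ∈ s, {f i}) : ∃ E ⊆ s, ∑ i ∈ E, {f i} = b := by
  suffices exists_le : ∃ t ≤ s.val, t.map f = b by
    obtain ⟨t, ht, rfl⟩ := exists_le
    exact ⟨⟨t, Multiset.nodup_of_le ht s.nodup⟩, Finset.val_le_iff.1 ht, sum_singleton_eq_map _ f⟩
  rw [sum_singleton_eq_map] at h
  generalize s.val = t at h
  induction t using Quotient.inductionOn with | _ u
  induction b using Quotient.inductionOn with | _ v
  obtain ⟨w, hw, hsub⟩ := h
  obtain ⟨u', hu', rfl⟩ := List.sublist_map_iff.1 hsub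
  exact ⟨u', hu'.subperm, Quotient.sound hw⟩

theorem exists_sum_cosRat_eq_zero_of_shortSolutions {s : Finset ι} {k : ι → ℕ} {b l : List ℕ}
    (hb : b ∈ shortSolutions) (hbl : isSubmultiset b l = true)
    (hl : (l : Multiset ℕ) = ∑ i ∈ s, {k i}) :
    ∃ E ⊆ s, E.Nonempty ∧ E.card = b.length ∧ ∑ i ∈ E, cosRat (k i / 60) = 0 := by
  obtain ⟨E, hE, hEb⟩ := exists_finset_of_le_sum_singleton (hl ▸ coe_le_of_isSubmultiset hbl)
  have hcard : E.card = b.length := by simpa using congrArg Multiset.card hEb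
  have length_pos : ∀ b ∈ shortSolutions, 0 < b.length := by decide
  refine ⟨E, hE, Finset.card_pos.1 (hcard ▸ length_pos b hb), hcard, ?_⟩
  have hsum := congrArg (fun m => (m.map fun k : ℕ => cosRat (k / 60)).sum) hEb
  simp only [sum_singleton_eq_map, Multiset.map_map, Multiset.map_coe, Multiset.sum_coe,
    sum_shortSolutions hb] at hsum
  exact hsum

theorem exists_numerator_sixty {x : ℚ} {K : ℤ} (hx : x * 60 = K) :
    ∃ k : ℕ, k ≤ 30 ∧ (Even k ↔ Even K) ∧ cosRat (k / 60) = cosRat x := by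
  obtain ⟨k, m, hk, hKk⟩ := exists_eq_add_mul_or_neg_add_mul (N := 60) (by norm_num) K
  obtain rfl : x = K / 60 := by
    rw [← hx]
    ring
  refine ⟨k, by omega, by grind, ?_⟩
  rcases hKk with rfl | rfl
  · rw [← cosRat_add_intCast _ m]
    congr 1
    push_cast
    ring
  · rw [← cosRat_neg, ← cosRat_add_intCast _ m]
    congr 1
    push_cast
    ring

end SixtySearch

section DenominatorSixty

/-- Whether the tuple with numerators `l` over `60` is equivalent to a sporadic tuple or to a member
of a family. -/
def isListedSixty (n : ℕ) (l : List ℕ) : Bool :=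
  matchesSome (cosSporadic n) (l.map fun k : ℕ => (k / 60 : ℚ)) ||
    matchesSome (cosSporadic n) (l.map fun k : ℕ => (1 / 2 - k / 60 : ℚ)) ||
    matchesSome ((cosFamilies n).flatMap fun F => (List.range 60).map fun t : ℕ => F (t / 60))
      (l.map fun k : ℕ => (k / 60 : ℚ))

/-- Whether the tuple with numerators `l` over `60` has a short proper part with vanishing sum of
cosines or is listed. -/
def isReducibleOrListedSixty (n : ℕ) (l : List ℕ) : Bool :=
  (shortSolutions.any fun b => Nat.blt b.length l.length && isSubmultiset b l) || isListedSixty n l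

set_option maxRecDepth 100000 in
theorem checkSums_isReducibleOrListedSixty : ∀ n ∈ [2, 3, 4, 5, 6],
    checkSums 9241 sixtyResidue (isReducibleOrListedSixty n) n ((List.range 16).map (2 * ·)) 0 [] ∧
      checkSums 9241 sixtyResidue (isReducibleOrListedSixty n) n
        ((List.range 15).map (2 * · + 1)) 0 [] := by
  decide +kernel

theorem isListedCos_of_isListedSixty {n : ℕ} {φ : Fin n → ℚ} {l : List ℕ}
    (hl : cosMultiset φ = l.map fun k : ℕ => cosRat (k / 60)) (h : isListedSixty n l = true) :
    IsListedCos φ := by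
  simp only [isListedSixty, Bool.or_eq_true, or_assoc] at h
  rcases h with h | h | h <;> obtain ⟨ψ, hψ, heq⟩ := exists_of_matchesSome h <;>
    rw [List.map_map] at heq
  · exact Or.inl ⟨ψ, hψ, cosEquiv_iff.2 (Or.inl (hl.trans heq.symm))⟩
  · refine Or.inl ⟨ψ, hψ, cosEquiv_iff.2 (Or.inr ?_)⟩
    simp only [hl, heq, Function.comp_def, cosRat_half_sub, Multiset.map_coe, List.map_map,
      neg_neg]
  · obtain ⟨F, hF, hψF⟩ := List.mem_flatMap.1 hψ
    obtain ⟨t, -, rfl⟩ := List.mem_map.1 hψF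
    exact Or.inr ⟨F, hF, t / 60, cosEquiv_iff.2 (Or.inl (hl.trans heq.symm))⟩

theorem IrreducibleCos.isListedCos_of_checkSums {n : ℕ} {φ : Fin n → ℚ} (hφ : IrreducibleCos φ)
    {keys : List ℕ}
    (hcheck : checkSums 9241 sixtyResidue (isReducibleOrListedSixty n) n keys 0 [] = true)
    {k : Fin n → ℕ} (hmem : ∀ j, k j ∈ keys) (hk : ∀ j, cosRat (k j / 60) = cosRat (φ j)) :
    IsListedCos φ := by
  obtain ⟨l, hl, hgood⟩ := exists_good_of_sum_cosRat_eq_zero (s := 0) hcheck (m := ∑ j, {k j})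
    (by simp) (by simpa using hmem) (by
      rw [zero_add, sum_singleton_eq_map, Multiset.map_map]
      exact (Finset.sum_congr rfl fun j _ => hk j).trans (irreducibleCos_iff.1 hφ).1)
  have hvalues : cosMultiset φ = l.map fun k : ℕ => cosRat (k / 60) := by
    rw [← Multiset.map_coe, hl, map_sum_singleton]
    simp only [hk]
    rfl
  simp only [isReducibleOrListedSixty, Bool.or_eq_true] at hgood
  refine isListedCos_of_isListedSixty hvalues (hgood.resolve_left fun hred => ?_)
  obtain ⟨b, hb, hbl⟩ := List.any_eq_true.1 hred
  rw [Bool.and_eq_true, Nat.blt_eq] at hbl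
  obtain ⟨E, -, hne, hcard, hsum⟩ := exists_sum_cosRat_eq_zero_of_shortSolutions hb hbl.2 hl
  have hE := (irreducibleCos_iff.1 hφ).eq_univ hne (by simpa only [hk] using hsum)
  have hlength : l.length = n := by simpa using congrArg Multiset.card hl
  rw [hE, Finset.card_univ, Fintype.card_fin] at hcard
  omega

theorem IrreducibleCos.isListedCos_of_denominator_sixty {n : ℕ} {φ : Fin n → ℚ}
    (hφ : IrreducibleCos φ) (hn : 1 < n) (hn6 : n ≤ 6) {K : Fin n → ℤ} (hK : ∀ j, φ j * 60 = K j)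
    (parity : (∀ j, Even (K j)) ∨ ∀ j, Odd (K j)) : IsListedCos φ := by
  have hcheck := checkSums_isReducibleOrListedSixty n (by simp only [List.mem_cons]; omega)
  choose k hk_le hk_even hk using fun j => exists_numerator_sixty (hK j)
  rcases parity with even | odd
  · refine hφ.isListedCos_of_checkSums hcheck.1 (fun j => ?_) hk
    obtain ⟨r, hr⟩ := (hk_even j).2 (even j)
    have := hk_le j
    exact List.mem_map.2 ⟨r, List.mem_range.2 (by omega), by omega⟩
  · refine hφ.isListedCos_of_checkSums hcheck.2 (fun j => ?_) hk
    obtain ⟨r, hr⟩ := Nat.not_even_iff_odd.1 (mt (hk_even j).1 (Int.not_even_iff_odd.2 (odd j)))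
    have := hk_le j
    exact List.mem_map.2 ⟨r, List.mem_range.2 (by omega), hr.symm⟩

end DenominatorSixty

section ExpFamilies

theorem forall_mem_expFamilies {P : ∀ {n : ℕ}, (ℚ → Fin n → ℚ) → Prop}
    (two : P fun θ => ![θ, θ + 1 / 2]) (three : P fun θ => ![θ, θ + 1 / 3, θ + 2 / 3])
    (five : P fun θ => ![θ, θ + 1 / 5, θ + 2 / 5, θ + 3 / 5, θ + 4 / 5])
    (six : P fun θ => ![θ - 1 / 6, θ + 1 / 6, θ + 1 / 5, θ + 2 / 5, θ + 3 / 5, θ + 4 / 5]) :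
    ∀ {n : ℕ}, ∀ F ∈ expFamilies n, P F
  | 0, _, hF | 1, _, hF | 4, _, hF | _ + 7, _, hF => by simp [expFamilies] at hF
  | 2, _, hF => List.mem_singleton.1 hF ▸ two
  | 3, _, hF => List.mem_singleton.1 hF ▸ three
  | 5, _, hF => List.mem_singleton.1 hF ▸ five
  | 6, _, hF => List.mem_singleton.1 hF ▸ six

variable {n : ℕ} {F : ℚ → Fin n → ℚ}

theorem expFamilies_add (hF : F ∈ expFamilies n) (θ c : ℚ) (j : Fin n) :
    F (θ + c) j = F θ j + c := by
  revert j
  apply forall_mem_expFamilies ?_ ?_ ?_ ?_ F hF <;> intro j <;> fin_cases j <;> simp <;> ring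

theorem expRat_sixth_pair : expRat (1 / 6) + expRat (-(1 / 6)) = 1 := by
  rw [expRat_add_expRat_neg, cosRat_sixth]
  norm_num

theorem sum_expFamilies (hF : F ∈ expFamilies n) (θ : ℚ) : ∑ j, expRat (F θ j) = 0 := by
  apply forall_mem_expFamilies ?_ ?_ ?_ ?_ F hF
  · simpa [Finset.sum_range_succ] using sum_range_expRat_add_div (p := 2) (by norm_num) θ
  · simpa [Finset.sum_range_succ, Fin.sum_univ_succ, add_assoc] using
      sum_range_expRat_add_div (p := 3) (by norm_num) θ
  · simpa [Finset.sum_range_succ, Fin.sum_univ_succ, add_assoc] using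
      sum_range_expRat_add_div (p := 5) (by norm_num) θ
  · have hfive := sum_range_expRat_add_div (p := 5) (by norm_num) θ
    have hsixth : expRat (θ - 1 / 6) + expRat (θ + 1 / 6) = expRat θ := by
      rw [sub_eq_add_neg, expRat_add, expRat_add, ← mul_add, add_comm (expRat (-(1 / 6))),
        expRat_sixth_pair, mul_one]
    simp only [Finset.sum_range_succ, Finset.sum_range_zero, Nat.cast_zero, zero_div, add_zero,
      zero_add, Nat.cast_ofNat, Nat.cast_one] at hfive
    simp only [Fin.sum_univ_six, Matrix.cons_val]
    rw [hsixth, hfive]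

theorem expRat_expFamilies_injective (hF : F ∈ expFamilies n) (θ : ℚ) :
    Function.Injective fun j => expRat (F θ j) := by
  have not_integral : ∀ i j, i ≠ j → (F 0 i - F 0 j).den ≠ 1 := by
    apply forall_mem_expFamilies ?_ ?_ ?_ ?_ F hF <;> decide +kernel
  refine fun i j hij => by_contra fun hne => not_integral i j hne ?_
  obtain ⟨m, hm⟩ := expRat_eq_iff.1 hij
  rw [← zero_add θ, expFamilies_add hF, expFamilies_add hF] at hm
  rw [show F 0 i - F 0 j = m by linear_combination hm, Rat.den_intCast]

end ExpFamilies

section ExpEquation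

variable {n : ℕ} {φ : Fin n → ℚ}

theorem IsListedExp.of_sub_const {c : ℚ} (h : IsListedExp fun j => φ j - c) : IsListedExp φ := by
  obtain ⟨F, hF, θ, σ, h⟩ := h
  refine ⟨F, hF, θ + c, σ, fun j => ?_⟩
  obtain ⟨m, hm⟩ := h j
  exact ⟨m, by rw [expFamilies_add hF]; linear_combination hm⟩

theorem IrreducibleExp.isListedExp_of_forall_exists (hφ : IrreducibleExp φ) {m : ℕ} [NeZero m]
    {F : ℚ → Fin m → ℚ} (hF : F ∈ expFamilies m) {θ : ℚ}
    (h : ∀ k, ∃ j, expRat (φ j) = expRat (F θ k)) : IsListedExp φ := by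
  choose e he using h
  have he_inj : Function.Injective e := fun k l hkl =>
    expRat_expFamilies_injective hF θ (by simp only [← he, hkl])
  have hsum : ∑ j ∈ Finset.univ.map ⟨e, he_inj⟩, expRat (φ j) = 0 := by
    simp only [Finset.sum_map, Function.Embedding.coeFn_mk, he]
    exact sum_expFamilies hF θ
  have himage := (irreducibleExp_iff.1 hφ).eq_univ (Finset.univ_nonempty.map) hsum
  have he_surj : Function.Surjective e := by
    simpa [Finset.ext_iff, Function.Surjective] using himage
  obtain rfl : m = n := by
    simpa using Fintype.card_congr (Equiv.ofBijective e ⟨he_inj, he_surj⟩)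
  refine ⟨F, hF, θ, expEquiv_iff.2 ?_⟩
  simp only [expMultiset, ← he]
  exact (sum_singleton_comp_perm (Equiv.ofBijective e ⟨he_inj, he_surj⟩)
    fun j => expRat (φ j)).symm

theorem expRat_add_eq_one {u v : ℚ} (h : expRat u + expRat v = 1) :
    (expRat u = expRat (1 / 6) ∧ expRat v = expRat (-(1 / 6))) ∨
      (expRat u = expRat (-(1 / 6)) ∧ expRat v = expRat (1 / 6)) := by
  have hconj : expRat (-u) + expRat (-v) = 1 := by
    rw [← conj_expRat, ← conj_expRat, ← map_add, h, map_one]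
  have hu := expRat_mul_expRat_neg u
  have hv := expRat_mul_expRat_neg v
  have hsixth := expRat_mul_expRat_neg (1 / 6)
  have hpair := expRat_sixth_pair
  have huv : expRat u * expRat v = 1 := by
    linear_combination expRat v * hu + expRat u * hv - expRat u * expRat v * hconj + h
  have hroot : (expRat u - expRat (1 / 6)) * (expRat u - expRat (-(1 / 6))) = 0 := by
    linear_combination expRat u * h - huv + hsixth - expRat u * hpair
  rcases mul_eq_zero.1 hroot with hu | hu
  · exact Or.inl ⟨sub_eq_zero.1 hu, by linear_combination h - hu - hpair⟩
  · exact Or.inr ⟨sub_eq_zero.1 hu, by linear_combination h - hu - hpair⟩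

theorem exists_forall_ne_eq_zero_of_sum_le_one {α : Type*} [Fintype α] [Nonempty α] {f : α → ℕ}
    (h : ∑ c, f c ≤ 1) : ∃ c₀, f c₀ ≤ 1 ∧ ∀ c, c ≠ c₀ → f c = 0 := by
  classical
  by_cases hzero : ∀ c, f c = 0
  · exact ⟨Classical.arbitrary α, by simp [hzero], fun c _ => hzero c⟩
  · obtain ⟨c₀, hc₀⟩ := not_forall.1 hzero
    rw [← Finset.add_sum_erase _ _ (Finset.mem_univ c₀)] at h
    refine ⟨c₀, by omega, fun c hc => ?_⟩
    have hrest : ∑ c ∈ Finset.univ.erase c₀, f c = 0 := by omega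
    exact Finset.sum_eq_zero_iff.1 hrest c (Finset.mem_erase.2 ⟨hc, Finset.mem_univ c⟩)

theorem squarefree_commonDenominator_of_irreducibleExp (hφ : IrreducibleExp φ) {z : Fin n}
    (hz : φ z = 0) : Squarefree (commonDenominator φ) := by
  refine Nat.squarefree_iff_prime_squarefree.2 fun p hp ⟨M, hM⟩ => ?_
  rw [mul_assoc] at hM
  have : NeZero p := ⟨hp.ne_zero⟩
  choose k hk using fun j => den_dvd_iff.1 (hM ▸ den_dvd_commonDenominator φ j)
  have hkz : k z = 0 := by
    have := hk z
    rw [hz, zero_mul] at this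
    exact_mod_cast this.symm
  have hclass : Finset.univ.filter (fun j => (k j : ZMod p) = 0) = Finset.univ :=
    (irreducibleExp_iff.1 hφ).eq_univ ⟨z, by simp [hkz]⟩
      (sum_filter_expRat_eq_zero (right_ne_zero_of_mul (hM ▸ commonDenominator_ne_zero φ))
        (e := 1) (by rw [pow_one]; exact dvd_mul_right p M) hk hφ.1 0)
  obtain ⟨j, hj⟩ := exists_not_den_dvd hp.one_lt hM
  exact hj (den_dvd_of_dvd_numerator hp.ne_zero (hk j)
    ((ZMod.intCast_zmod_eq_zero_iff_dvd _ _).1 (Finset.filter_eq_self.1 hclass _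
      (Finset.mem_univ j))))

/-- A tuple of entries `a j / p + b j` in which every residue class of numerators contributes the
same nonzero component `α` to the sum of the exponentials. -/
structure IsExpSplitting (p : ℕ) (φ : Fin n → ℚ) (a : Fin n → ℤ) (b : Fin n → ℚ) (α : ℂ) :
    Prop where
  eq_add : ∀ j, φ j = a j / p + b j
  ne_zero : α ≠ 0
  sum_class : ∀ c : ZMod p, ∑ j with (a j : ZMod p) = c, expRat (b j) = α

theorem IsExpSplitting.exists_class {p : ℕ} {a : Fin n → ℤ} {b : Fin n → ℚ} {α : ℂ}
    (h : IsExpSplitting p φ a b α) (c : ZMod p) :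
    (Finset.univ.filter fun j => (a j : ZMod p) = c).Nonempty :=
  Finset.nonempty_of_sum_ne_zero (h.sum_class c ▸ h.ne_zero)

theorem IsExpSplitting.le {p : ℕ} [NeZero p] {a : Fin n → ℤ} {b : Fin n → ℚ} {α : ℂ}
    (h : IsExpSplitting p φ a b α) : p ≤ n := by
  have hsurj : Function.Surjective fun j => (a j : ZMod p) := fun c =>
    (h.exists_class c).imp fun j hj => by simpa using hj
  simpa [ZMod.card] using Fintype.card_le_of_surjective _ hsurj

theorem IrreducibleExp.exists_isExpSplitting (hφ : IrreducibleExp φ) {z : Fin n} (hz : φ z = 0)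
    {p M : ℕ} [Fact p.Prime] (hN : commonDenominator φ = p * M) :
    ∃ a b α, IsExpSplitting p φ a b α ∧ ∀ j, (b j).den ∣ M := by
  have hp : p.Prime := Fact.out
  have hp0 : (p : ℚ) ≠ 0 := Nat.cast_ne_zero.2 hp.ne_zero
  have hM : M ≠ 0 := right_ne_zero_of_mul (hN ▸ commonDenominator_ne_zero φ)
  have hpM : p.Coprime M :=
    Nat.coprime_of_squarefree_mul (hN ▸ squarefree_commonDenominator_of_irreducibleExp hφ hz)
  choose a b hab hb using fun j =>
    exists_eq_div_add hp.ne_zero hM hpM (hN ▸ den_dvd_commonDenominator φ j)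
  have hsum : ∑ j, expRat (a j / p + b j) = 0 := by
    simp only [← hab]
    exact hφ.1
  have hcomponent (c : ZMod p) : ∑ j with (a j : ZMod p) = c, expRat (b j) =
      (∑ j, expRat (b j)) / p := by
    rw [eq_div_iff (Nat.cast_ne_zero.2 hp.ne_zero), mul_comm]
    exact mul_sum_filter_expRat_eq hM hpM hb hsum c
  refine ⟨a, b, _, ⟨hab, fun hzero => ?_, hcomponent⟩, hb⟩
  have hclass : Finset.univ.filter (fun j => (a j : ZMod p) = a z) = Finset.univ := by
    refine (irreducibleExp_iff.1 hφ).eq_univ ⟨z, by simp⟩ ?_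
    rw [← mul_zero (expRat (a z / p)), ← hzero, ← hcomponent (a z), Finset.mul_sum]
    refine Finset.sum_congr rfl fun j hj => ?_
    rw [hab, expRat_add, expRat_div_eq_stdAddChar, expRat_div_eq_stdAddChar,
      (Finset.mem_filter.1 hj).2]
  obtain ⟨j, hj⟩ := exists_not_den_dvd hp.one_lt hN
  obtain ⟨m, hm⟩ : (p : ℤ) ∣ a j - a z := by
    rw [← ZMod.intCast_zmod_eq_zero_iff_dvd, Int.cast_sub, sub_eq_zero]
    exact Finset.filter_eq_self.1 hclass _ (Finset.mem_univ j)
  have hφj : φ j = m + (b j - b z) := by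
    have haj : (a j : ℚ) = a z + p * m := by exact_mod_cast sub_eq_iff_eq_add'.1 hm
    rw [← sub_zero (φ j), ← hz, hab, hab, haj]
    field_simp
    ring
  refine hj (hφj ▸ (Rat.add_den_dvd_lcm _ _).trans (Nat.lcm_dvd (by simp) ?_))
  exact (Rat.sub_den_dvd_lcm _ _).trans (Nat.lcm_dvd (hb j) (hb z))

section Splittings

variable {p : ℕ} [NeZero p] {a : Fin n → ℤ} {b : Fin n → ℚ} {α : ℂ}

theorem IsExpSplitting.expRat_eq (h : IsExpSplitting p φ a b α) {j : Fin n} {c : ZMod p}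
    {θ : ℚ} (k : ℕ) (ha : (a j : ZMod p) = c + k) (hb : expRat (b j) = expRat θ) :
    expRat (φ j) = expRat (c.val / p + θ + k / p) := by
  have hnum : ((a j : ℤ) : ZMod p) = ((c.val + k : ℤ) : ZMod p) := by
    push_cast
    rw [ha, ZMod.natCast_zmod_val]
  rw [h.eq_add, expRat_add, hb, expRat_div_eq_stdAddChar, hnum, ← expRat_div_eq_stdAddChar,
    ← expRat_add]
  congr 1
  push_cast
  ring

theorem IsExpSplitting.exists_forall_ne_eq_singleton (h : IsExpSplitting p φ a b α)
    (hn : n ≤ p + 1) :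
    ∃ c₀ : ZMod p, (Finset.univ.filter fun j => (a j : ZMod p) = c₀).card ≤ 2 ∧
      ∀ c ≠ c₀, ∃ j, (Finset.univ.filter fun j => (a j : ZMod p) = c) = {j} := by
  have hpos (c : ZMod p) := (h.exists_class c).card_pos
  have hcard : ∑ c : ZMod p, (Finset.univ.filter fun j => (a j : ZMod p) = c).card = n := by
    simpa using (Finset.card_eq_sum_card_fiberwise (s := Finset.univ) (t := Finset.univ)
      (f := fun j => (a j : ZMod p)) fun _ _ => Finset.mem_coe.2 (Finset.mem_univ _)).symm
  have hexcess : ∑ c : ZMod p, ((Finset.univ.filter fun j => (a j : ZMod p) = c).card - 1) ≤ 1 := by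
    rw [Finset.sum_tsub_distrib _ fun c _ => hpos c, hcard]
    simp [ZMod.card]
    omega
  obtain ⟨c₀, hc₀, hc⟩ := exists_forall_ne_eq_zero_of_sum_le_one hexcess
  refine ⟨c₀, by omega, fun c hne => Finset.card_eq_one.1 ?_⟩
  have := hpos c
  have := hc c hne
  omega

theorem IsExpSplitting.exists_forall_exists_expRat_eq (h : IsExpSplitting p φ a b α)
    (hp : 1 < p) (hn : n ≤ p + 1) :
    ∃ (c₀ : ZMod p) (θ : ℚ), (Finset.univ.filter fun j => (a j : ZMod p) = c₀).card ≤ 2 ∧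
      expRat θ = α ∧
      ∀ k : ℕ, (k : ZMod p) ≠ 0 → ∃ j, expRat (φ j) = expRat (c₀.val / p + θ + k / p) := by
  obtain ⟨c₀, hc₀, hsingle⟩ := h.exists_forall_ne_eq_singleton hn
  have hsingle (k : ℕ) (hk : (k : ZMod p) ≠ 0) :
      ∃ j, (a j : ZMod p) = c₀ + k ∧ expRat (b j) = α := by
    obtain ⟨j, hj⟩ := hsingle (c₀ + k) (by simpa using hk)
    have hmem := hj ▸ Finset.mem_singleton_self j
    refine ⟨j, (Finset.mem_filter.1 hmem).2, ?_⟩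
    rw [← h.sum_class (c₀ + k), hj, Finset.sum_singleton]
  have : Fact (1 < p) := ⟨hp⟩
  obtain ⟨j, -, rfl⟩ := hsingle 1 (by simp)
  exact ⟨c₀, b j, hc₀, rfl, fun k hk =>
    (hsingle k hk).imp fun i ⟨ha, hb⟩ => h.expRat_eq k ha hb⟩

end Splittings

theorem expRat_eq_and_eq_of_add_eq {x y θ : ℚ} (h : expRat x + expRat y = expRat θ) :
    (expRat x = expRat (θ + 1 / 6) ∧ expRat y = expRat (θ - 1 / 6)) ∨
      (expRat x = expRat (θ - 1 / 6) ∧ expRat y = expRat (θ + 1 / 6)) := by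
  have hone : expRat (x - θ) + expRat (y - θ) = 1 := by
    rw [sub_eq_add_neg, sub_eq_add_neg, expRat_add, expRat_add, ← add_mul, h,
      expRat_mul_expRat_neg]
  have shift {z w : ℚ} (hz : expRat (z - θ) = expRat w) : expRat z = expRat (θ + w) := by
    rw [expRat_add, ← hz, ← expRat_add, add_sub_cancel]
  rw [sub_eq_add_neg θ]
  exact (expRat_add_eq_one hone).imp (fun ⟨hx, hy⟩ => ⟨shift hx, shift hy⟩)
    fun ⟨hx, hy⟩ => ⟨shift hx, shift hy⟩

/-- At most one class is not a singleton; the listed sextuples arise by writing one of five equally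
spaced roots of unity as the sum of two others. -/
theorem IrreducibleExp.isListedExp_of_isExpSplitting_five (hφ : IrreducibleExp φ) (hn : n ≤ 6)
    {a : Fin n → ℤ} {b : Fin n → ℚ} {α : ℂ} (h : IsExpSplitting 5 φ a b α) : IsListedExp φ := by
  obtain ⟨c₀, θ, hc₀, rfl, hrest⟩ := h.exists_forall_exists_expRat_eq (by norm_num) hn
  have hrest₁ := hrest 1 (by decide)
  have hrest₂ := hrest 2 (by decide)
  have hrest₃ := hrest 3 (by decide)
  have hrest₄ := hrest 4 (by decide)
  have hbase (j : Fin n) {η : ℚ}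
      (hj : j ∈ Finset.univ.filter fun j => (a j : ZMod 5) = c₀) (hb : expRat (b j) = expRat η) :
      expRat (φ j) = expRat (c₀.val / 5 + η) := by
    simpa using h.expRat_eq (c := c₀) 0 (by simpa using hj) hb
  push_cast at hrest₁ hrest₂ hrest₃ hrest₄
  obtain hone | htwo : (Finset.univ.filter fun j => (a j : ZMod 5) = c₀).card = 1 ∨
      (Finset.univ.filter fun j => (a j : ZMod 5) = c₀).card = 2 := by
    have := (h.exists_class c₀).card_pos
    omega
  · obtain ⟨j, hE⟩ := Finset.card_eq_one.1 hone
    have hsum := h.sum_class c₀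
    rw [hE] at hbase hsum
    have hj := hbase j (Finset.mem_singleton_self j) ((Finset.sum_singleton _ _).symm.trans hsum)
    refine hφ.isListedExp_of_forall_exists (m := 5) (List.mem_singleton_self _)
      (θ := c₀.val / 5 + θ) fun k => ?_
    fin_cases k
    exacts [⟨j, hj⟩, hrest₁, hrest₂, hrest₃, hrest₄]
  · obtain ⟨i, j, hij, hE⟩ := Finset.card_eq_two.1 htwo
    have hsum := h.sum_class c₀
    rw [hE, Finset.sum_pair hij] at hsum
    simp only [hE, Finset.mem_insert, Finset.mem_singleton] at hbase
    have hsixth : (∃ j, expRat (φ j) = expRat (c₀.val / 5 + θ - 1 / 6)) ∧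
        ∃ j, expRat (φ j) = expRat (c₀.val / 5 + θ + 1 / 6) := by
      rw [add_sub_assoc, add_assoc]
      rcases expRat_eq_and_eq_of_add_eq hsum with ⟨hbi, hbj⟩ | ⟨hbi, hbj⟩
      · exact ⟨⟨j, hbase j (Or.inr rfl) hbj⟩, ⟨i, hbase i (Or.inl rfl) hbi⟩⟩
      · exact ⟨⟨i, hbase i (Or.inl rfl) hbi⟩, ⟨j, hbase j (Or.inr rfl) hbj⟩⟩
    refine hφ.isListedExp_of_forall_exists (m := 6) (List.mem_singleton_self _)
      (θ := c₀.val / 5 + θ) fun k => ?_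
    fin_cases k
    exacts [hsixth.1, hsixth.2, hrest₁, hrest₂, hrest₃, hrest₄]

theorem expRat_eq_zero_or_half_of_den_dvd_two {x : ℚ} (hx : x.den ∣ 2) :
    expRat x = expRat 0 ∨ expRat x = expRat (1 / 2) := by
  obtain ⟨k, hk⟩ := den_dvd_iff.1 hx
  simp only [expRat_eq_iff, EqModOne]
  rcases Int.even_or_odd' k with ⟨m, rfl | rfl⟩ <;> push_cast at hk
  · exact Or.inl ⟨m, by linear_combination hk / 2⟩
  · exact Or.inr ⟨m, by linear_combination hk / 2⟩

theorem IsExpSplitting.exists_forall_exists_of_den_dvd_two {p : ℕ} [NeZero p] {a : Fin n → ℤ}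
    {b : Fin n → ℚ} {α : ℂ} (h : IsExpSplitting p φ a b α) (hb : ∀ j, (b j).den ∣ 2) :
    ∃ θ, ∀ c : ZMod p, ∃ j, (a j : ZMod p) = c ∧ expRat (b j) = expRat θ := by
  by_contra! hnone
  obtain ⟨c, hc⟩ := hnone 0
  obtain ⟨d, hd⟩ := hnone (1 / 2)
  have hneg : α = -(Finset.univ.filter fun j => (a j : ZMod p) = c).card := by
    rw [← h.sum_class c, Finset.sum_congr rfl fun j hj =>
      (expRat_eq_zero_or_half_of_den_dvd_two (hb j)).resolve_left (hc j (by simpa using hj))]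
    simp [expRat_half, -one_div]
  have hpos : α = (Finset.univ.filter fun j => (a j : ZMod p) = d).card := by
    rw [← h.sum_class d, Finset.sum_congr rfl fun j hj =>
      (expRat_eq_zero_or_half_of_den_dvd_two (hb j)).resolve_right (hd j (by simpa using hj))]
    simp [expRat_zero]
  have hcard : (Finset.univ.filter fun j => (a j : ZMod p) = d).card +
      (Finset.univ.filter fun j => (a j : ZMod p) = c).card = 0 := by
    have : (_ : ℂ) + _ = 0 := eq_neg_iff_add_eq_zero.1 (hpos.symm.trans hneg)
    exact_mod_cast this
  have := (h.exists_class d).card_pos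
  omega

theorem IrreducibleExp.isListedExp_of_isExpSplitting (hφ : IrreducibleExp φ) {p : ℕ} [NeZero p]
    {a : Fin n → ℤ} {b : Fin n → ℚ} {α : ℂ} (h : IsExpSplitting p φ a b α)
    (hb : ∀ j, (b j).den ∣ 2) {F : ℚ → Fin p → ℚ} (hF : F ∈ expFamilies p)
    (hFk : ∀ θ k, F θ k = θ + (k : ℕ) / p) : IsListedExp φ := by
  obtain ⟨θ, hθ⟩ := h.exists_forall_exists_of_den_dvd_two hb
  refine hφ.isListedExp_of_forall_exists hF (θ := θ) fun k => ?_
  obtain ⟨j, ha, hb⟩ := hθ (k : ℕ)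
  refine ⟨j, ?_⟩
  simpa [hFk] using h.expRat_eq (c := 0) k (by simpa using ha) hb

theorem dvd_of_squarefree_of_forall_prime_dvd {N K : ℕ} (hN : Squarefree N)
    (h : ∀ p : ℕ, p.Prime → p ∣ N → p ∣ K) : N ∣ K := by
  rw [← Nat.prod_primeFactors_of_squarefree hN]
  exact Finset.prod_primes_dvd K (fun p hp => (Nat.prime_of_mem_primeFactors hp).prime)
    fun p hp => h p (Nat.prime_of_mem_primeFactors hp) (Nat.dvd_of_mem_primeFactors hp)

theorem IrreducibleExp.commonDenominator_ne_one (hφ : IrreducibleExp φ) [NeZero n] :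
    commonDenominator φ ≠ 1 := fun hone => by
  have hterm (j : Fin n) : expRat (φ j) = 1 := by
    obtain ⟨m, hm⟩ := den_dvd_iff.1 (hone ▸ den_dvd_commonDenominator φ j)
    rw [← expRat_intCast m, ← hm, Nat.cast_one, mul_one]
  have hsum : ∑ j, expRat (φ j) = 0 := hφ.1
  simp [hterm, NeZero.ne] at hsum

theorem IrreducibleExp.isListedExp_of_eq_zero (hφ : IrreducibleExp φ) (hn : n ≤ 6) {z : Fin n}
    (hz : φ z = 0) : IsListedExp φ := by
  have hsq := squarefree_commonDenominator_of_irreducibleExp hφ hz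
  have splitting (p : ℕ) [Fact p.Prime] (hp : p ∣ commonDenominator φ) :
      ∃ a b α, IsExpSplitting p φ a b α ∧ ∀ j, p * (b j).den ∣ commonDenominator φ := by
    obtain ⟨M, hM⟩ := hp
    obtain ⟨a, b, α, h, hb⟩ := hφ.exists_isExpSplitting hz hM
    exact ⟨a, b, α, h, fun j => hM ▸ Nat.mul_dvd_mul_left p (hb j)⟩
  have hle (p : ℕ) (hp : p.Prime) (hd : p ∣ commonDenominator φ) : p ≤ 6 := by
    have : Fact p.Prime := ⟨hp⟩
    obtain ⟨_, _, _, h, -⟩ := splitting p hd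
    exact h.le.trans hn
  by_cases h5 : 5 ∣ commonDenominator φ
  · have : Fact (Nat.Prime 5) := ⟨by norm_num⟩
    obtain ⟨a, b, α, h, -⟩ := splitting 5 h5
    exact hφ.isListedExp_of_isExpSplitting_five hn h
  have hdvd : commonDenominator φ ∣ 6 :=
    dvd_of_squarefree_of_forall_prime_dvd hsq fun p hp hd => by
      have := hle p hp hd
      interval_cases p <;> first | decide | exact absurd hd h5 | exact absurd hp (by norm_num)
  by_cases h3 : 3 ∣ commonDenominator φ
  · have : Fact (Nat.Prime 3) := ⟨by norm_num⟩
    obtain ⟨a, b, α, h, hb⟩ := splitting 3 h3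
    refine hφ.isListedExp_of_isExpSplitting h (fun j => ?_) (List.mem_singleton_self _) ?_
    · exact Nat.dvd_of_mul_dvd_mul_left (by norm_num) ((hb j).trans hdvd)
    · intro θ k
      fin_cases k <;> simp
  · have htwo : commonDenominator φ = 2 := by
      have : NeZero n := z.neZero
      have hone := hφ.commonDenominator_ne_one
      have := Nat.le_of_dvd (by norm_num) hdvd
      interval_cases commonDenominator φ <;> omega
    obtain ⟨a, b, α, h, hb⟩ := splitting 2 (dvd_of_eq htwo.symm)
    refine hφ.isListedExp_of_isExpSplitting h (fun j => ?_) (List.mem_singleton_self _) ?_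
    · exact (dvd_mul_left _ 2).trans ((hb j).trans (dvd_of_eq htwo))
    · intro θ k
      fin_cases k <;> simp

theorem IrreducibleExp.isListedExp (hφ : IrreducibleExp φ) (h1 : 1 ≤ n) (hn : n ≤ 6) :
    IsListedExp φ := by
  have : NeZero n := ⟨by omega⟩
  have hφ' : IrreducibleExp fun j => φ j - φ 0 := by
    rw [irreducibleExp_iff] at *
    simpa only [← expRat_add, neg_add_eq_sub] using hφ.const_mul (expRat_ne_zero (-φ 0))
  exact (hφ'.isListedExp_of_eq_zero hn (sub_self (φ 0))).of_sub_const

end ExpEquation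

section CosSquares

variable {n : ℕ} {φ : Fin n → ℚ}

theorem IrreducibleCos.congr {ψ : Fin n → ℚ} (hφ : IrreducibleCos φ)
    (h : ∀ j, cosRat (ψ j) = cosRat (φ j)) : IrreducibleCos ψ := by
  rw [irreducibleCos_iff] at *
  simpa only [h] using hφ

theorem sum_cosRat_add_eq_zero {ι : Type*} {s t : Finset ι} {x : ι → ℚ}
    (h : ∑ j ∈ s, expRat (x j) + ∑ j ∈ t, expRat (-x j) = 0) :
    ∑ j ∈ s, cosRat (x j) + ∑ j ∈ t, cosRat (x j) = 0 := by
  simpa only [Complex.add_re, Complex.re_sum, expRat_re, Complex.zero_re, cosRat_neg]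
    using congrArg Complex.re h

theorem IrreducibleCos.irreducibleExp (hφ : IrreducibleCos φ) (h : ∑ j, expRat (φ j) = 0) :
    IrreducibleExp φ := by
  refine ⟨h, fun E hE hne hsum => (irreducibleCos_iff.1 hφ).2 E hE hne ?_⟩
  simpa using sum_cosRat_add_eq_zero (t := ∅) ((add_zero _).trans hsum)

theorem IrreducibleCos.isListedCos_of_disjoint (hφ : IrreducibleCos φ) (hn : n ≤ 6)
    {S T : Finset (Fin n)} (hST : Disjoint S T) (hS : S.Nonempty)
    (h : ∑ j ∈ S, expRat (φ j) + ∑ j ∈ T, expRat (-φ j) = 0) : IsListedCos φ := by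
  have huniv : S ∪ T = Finset.univ :=
    (irreducibleCos_iff.1 hφ).eq_univ (hS.mono Finset.subset_union_left)
      ((Finset.sum_union hST).trans (sum_cosRat_add_eq_zero h))
  let ψ (j : Fin n) : ℚ := if j ∈ S then φ j else -φ j
  have hψ (j : Fin n) : cosRat (ψ j) = cosRat (φ j) := by
    by_cases hj : j ∈ S <;> simp [ψ, hj, cosRat_neg]
  have hsum : ∑ j, expRat (ψ j) = 0 := by
    rw [← huniv, Finset.sum_union hST, ← h]
    exact congrArg₂ _ (Finset.sum_congr rfl fun j hj => by simp only [ψ, if_pos hj])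
      (Finset.sum_congr rfl fun j hj => by simp only [ψ, if_neg (Finset.disjoint_right.1 hST hj)])
  obtain ⟨i, -⟩ := hS
  exact (((hφ.congr hψ).irreducibleExp hsum).isListedExp i.pos hn).isListedCos.congr
    fun j => hψ j

theorem sum_expRat_sumElim_neg {ι : Type*} [Fintype ι] {x : ι → ℚ} (h : ∑ j, cosRat (x j) = 0) :
    ∑ i, expRat (Sum.elim x (-x) i) = 0 := by
  rw [Fintype.sum_sum_type, ← Finset.sum_add_distrib]
  simp only [Sum.elim_inl, Sum.elim_inr, Pi.neg_apply, expRat_add_expRat_neg, ← Finset.mul_sum,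
    ← Complex.ofReal_sum, h, Complex.ofReal_zero, mul_zero]

theorem sum_filter_sumElim_neg {ι : Type*} [Fintype ι] {p : ℕ} (k : ι → ℤ) (x : ι → ℚ)
    (c : ZMod p) :
    ∑ i with ((Sum.elim k (-k) i : ℤ) : ZMod p) = c, expRat (Sum.elim x (-x) i) =
      ∑ j with (k j : ZMod p) = c, expRat (x j) +
        ∑ j with -(k j : ZMod p) = c, expRat (-x j) := by
  simp only [Finset.sum_filter, Fintype.sum_sum_type, Sum.elim_inl, Sum.elim_inr, Pi.neg_apply,
    Int.cast_neg]
  rfl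

theorem IrreducibleCos.sum_class_eq_zero (hφ : IrreducibleCos φ) {p M e : ℕ} [NeZero p]
    (hM : M ≠ 0) (hpM : p ∣ M ^ e) {k : Fin n → ℤ} (hk : ∀ j, φ j * (p * M : ℕ) = k j)
    (c : ZMod p) :
    ∑ j with (k j : ZMod p) = c, expRat (φ j) + ∑ j with -(k j : ZMod p) = c, expRat (-φ j) =
      0 := by
  rw [← sum_filter_sumElim_neg]
  refine sum_filter_expRat_eq_zero hM hpM ?_ (sum_expRat_sumElim_neg (irreducibleCos_iff.1 hφ).1) c
  rintro (j | j)
  · exact hk j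
  · simp [← hk j]

theorem IrreducibleCos.isListedCos_of_dvd_pow (hφ : IrreducibleCos φ) (hn : n ≤ 6) {p M e : ℕ}
    [NeZero p] (hM : M ≠ 0) (hpM : p ∣ M ^ e) {k : Fin n → ℤ}
    (hk : ∀ j, φ j * (p * M : ℕ) = k j) {i : Fin n} (hi : (k i : ZMod p) ≠ -k i) :
    IsListedCos φ := by
  refine hφ.isListedCos_of_disjoint hn ?_ ⟨i, ?_⟩ (hφ.sum_class_eq_zero hM hpM hk (k i))
  · refine Finset.disjoint_filter.2 fun j _ hj hj' => hi ?_
    rw [← hj, ← hj'.trans hj.symm, neg_neg, hj', ← hj]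
  · simp

theorem exists_not_dvd_of_commonDenominator_eq {p M : ℕ} (hp : 1 < p)
    (h : commonDenominator φ = p * M) {k : Fin n → ℤ} (hk : ∀ j, φ j * (p * M : ℕ) = k j) :
    ∃ i, ¬ (p : ℤ) ∣ k i :=
  (exists_not_den_dvd hp h).imp fun i hi hd => hi (den_dvd_of_dvd_numerator (by omega) (hk i) hd)

theorem IrreducibleCos.isListedCos_of_odd_sq_dvd (hφ : IrreducibleCos φ) (hn : n ≤ 6) {p : ℕ}
    (hp : p.Prime) (hodd : p ≠ 2) (hd : p * p ∣ commonDenominator φ) : IsListedCos φ := by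
  obtain ⟨M, hM⟩ := hd
  rw [mul_assoc] at hM
  have : NeZero p := ⟨hp.ne_zero⟩
  choose k hk using fun j => den_dvd_iff.1 (hM ▸ den_dvd_commonDenominator φ j)
  obtain ⟨i, hi⟩ := exists_not_dvd_of_commonDenominator_eq hp.one_lt hM hk
  refine hφ.isListedCos_of_dvd_pow hn (right_ne_zero_of_mul (hM ▸ commonDenominator_ne_zero φ))
    (e := 1) (by simp) hk (ZMod.ne_neg_self (hp.odd_of_ne_two hodd) (a := k i) ?_)
  rwa [ne_eq, ZMod.intCast_zmod_eq_zero_iff_dvd]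

theorem IrreducibleCos.odd_numerator_of_four_dvd (hφ : IrreducibleCos φ) {k : Fin n → ℤ}
    (hk : ∀ j, φ j * commonDenominator φ = k j) (hd : 4 ∣ commonDenominator φ) (i : Fin n) :
    Odd (k i) := by
  obtain ⟨M, hM⟩ := hd
  replace hM : commonDenominator φ = 2 * (2 * M) := by rw [hM]; ring
  rw [hM] at hk
  have hsum := sum_cosRat_add_eq_zero <| hφ.sum_class_eq_zero
    (right_ne_zero_of_mul (hM ▸ commonDenominator_ne_zero φ)) (e := 1) (by simp) hk 1
  simp only [ZMod.neg_eq_self_mod_two, add_self_eq_zero, ZMod.intCast_eq_one_iff_odd] at hsum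
  obtain ⟨j, hj⟩ := exists_not_dvd_of_commonDenominator_eq one_lt_two hM hk
  have huniv := (irreducibleCos_iff.1 hφ).eq_univ
    ⟨j, by simpa [even_iff_two_dvd, ← Int.not_even_iff_odd] using hj⟩ hsum
  have hi := huniv ▸ Finset.mem_univ i
  exact (Finset.mem_filter.1 hi).2

theorem IrreducibleCos.isListedCos_of_eight_dvd (hφ : IrreducibleCos φ) (hn : n ≤ 6)
    (hd : 8 ∣ commonDenominator φ) : IsListedCos φ := by
  choose k hk using fun j => den_dvd_iff.1 (den_dvd_commonDenominator φ j)
  have hodd := hφ.odd_numerator_of_four_dvd hk (dvd_trans (by norm_num) hd)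
  obtain ⟨M, hM⟩ := hd
  replace hM : commonDenominator φ = 4 * (2 * M) := by rw [hM]; ring
  rw [hM] at hk
  obtain ⟨i, -⟩ := exists_not_den_dvd (by norm_num) hM
  refine hφ.isListedCos_of_dvd_pow hn (i := i)
    (right_ne_zero_of_mul (hM ▸ commonDenominator_ne_zero φ)) (e := 2) ?_ hk ?_
  · rw [mul_pow]
    exact dvd_mul_right 4 _
  · rw [ne_eq, ← sub_eq_zero, sub_neg_eq_add, ← Int.cast_add, ZMod.intCast_zmod_eq_zero_iff_dvd]
    have := hodd i
    grind

end CosSquares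

section CosComponents

variable {n : ℕ} {φ : Fin n → ℚ}

/-- The angles are `φⱼ = aⱼ/p + bⱼ` with `0 ≤ aⱼ < p/2`, and the components of the sum of the
numbers `2 cos (2πφⱼ)` along the `p`-th roots of unity are all equal to `α`. By symmetry only the
classes `0 ≤ c < p/2` are recorded. -/
structure IsCosSplitting (p : ℕ) (φ : Fin n → ℚ) (a : Fin n → ℕ) (b : Fin n → ℚ) (α : ℂ) :
    Prop where
  eq_add : ∀ j, φ j = a j / p + b j
  two_mul_lt : ∀ j, 2 * a j < p
  sum_class : ∀ c, 0 < c → 2 * c < p → ∑ j with a j = c, expRat (b j) = α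
  sum_zero : ∑ j with a j = 0, 2 * (cosRat (b j) : ℂ) = α

theorem exists_eq_div_add_or_neg {p M : ℕ} (hp : Odd p) (hM : M ≠ 0) (hpM : p.Coprime M) {x : ℚ}
    (hx : x.den ∣ p * M) :
    ∃ (a : ℕ) (b : ℚ), 2 * a < p ∧ b.den ∣ M ∧ (a / p + b = x ∨ a / p + b = -x) := by
  have hp0 : p ≠ 0 := hp.pos.ne'
  obtain ⟨A, B, rfl, hB⟩ := exists_eq_div_add hp0 hM hpM hx
  obtain ⟨a, m, ha, hA⟩ := exists_eq_add_mul_or_neg_add_mul hp0 A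
  have hden : (B + m).den ∣ M := by
    obtain ⟨k, hk⟩ := den_dvd_iff.1 hB
    exact den_dvd_iff.2 ⟨k + m * M, by push_cast [← hk]; ring⟩
  have ha' : 2 * a < p := by
    obtain ⟨r, rfl⟩ := hp
    omega
  rcases hA with rfl | rfl
  · refine ⟨a, B + m, ha', hden, Or.inl ?_⟩
    push_cast
    field_simp
    ring
  · refine ⟨a, -(B + m), ha', by rwa [Rat.den_neg_eq_den], Or.inr ?_⟩
    push_cast
    field_simp
    ring

theorem natCast_zmod_eq_iff_of_two_mul_lt {p a c : ℕ} (ha : 2 * a < p) (hc : 2 * c < p) :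
    (a : ZMod p) = c ↔ a = c := by
  rw [ZMod.natCast_eq_natCast_iff', Nat.mod_eq_of_lt (by omega), Nat.mod_eq_of_lt (by omega)]

theorem neg_natCast_zmod_eq_iff_of_two_mul_lt {p a c : ℕ} (ha : 2 * a < p) (hc : 2 * c < p) :
    -(a : ZMod p) = c ↔ a = 0 ∧ c = 0 := by
  rw [neg_eq_iff_add_eq_zero, ← Nat.cast_add, ZMod.natCast_eq_zero_iff, ← add_eq_zero]
  exact ⟨fun h => Nat.eq_zero_of_dvd_of_lt h (by omega), fun h => h ▸ dvd_zero p⟩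

theorem exists_isCosSplitting_of_eq_add {p M : ℕ} [Fact p.Prime] (hM : M ≠ 0) (hpM : p.Coprime M)
    {a : Fin n → ℕ} {b : Fin n → ℚ} (ha : ∀ j, 2 * a j < p) (hb : ∀ j, (b j).den ∣ M)
    (hφ : ∀ j, φ j = a j / p + b j) (hsum : ∑ j, cosRat (φ j) = 0) :
    ∃ α, IsCosSplitting p φ a b α := by
  have hp : 0 < p := NeZero.pos p
  have component (c : ℕ) : (p : ℂ) * (∑ j with ((a j : ℤ) : ZMod p) = c, expRat (b j) +
      ∑ j with -((a j : ℤ) : ZMod p) = c, expRat (-b j)) = ∑ i, expRat (Sum.elim b (-b) i) := by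
    rw [← sum_filter_sumElim_neg fun j => (a j : ℤ)]
    refine mul_sum_filter_expRat_eq hM hpM ?_ ?_ c
    · rintro (j | j)
      · exact hb j
      · exact (Rat.den_neg_eq_den (b j)).symm ▸ hb j
    · rw [← sum_expRat_sumElim_neg hsum]
      refine Finset.sum_congr rfl ?_
      rintro (j | j) - <;>
        simp only [Sum.elim_inl, Sum.elim_inr, Pi.neg_apply, hφ, Int.cast_neg, Int.cast_natCast]
      rw [neg_div, neg_add]
  simp only [Int.cast_natCast] at component
  have hzero := component 0
  simp only [Nat.cast_zero] at hzero
  refine ⟨_, hφ, ha, fun c hc hcp => ?_, rfl⟩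
  have heq := mul_left_cancel₀ (Nat.cast_ne_zero.2 hp.ne') ((component c).trans (component 0).symm)
  simp only [fun j => natCast_zmod_eq_iff_of_two_mul_lt (ha j) hcp,
    fun j => neg_natCast_zmod_eq_iff_of_two_mul_lt (ha j) hcp,
    fun j => natCast_zmod_eq_iff_of_two_mul_lt (c := 0) (ha j) hp,
    fun j => neg_natCast_zmod_eq_iff_of_two_mul_lt (c := 0) (ha j) hp, hc.ne', and_false, and_true,
    Finset.filter_false, Finset.sum_empty, add_zero, ← Finset.sum_add_distrib,
    expRat_add_expRat_neg] at heq
  exact heq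

theorem IrreducibleCos.exists_isCosSplitting (hφ : IrreducibleCos φ) {p M : ℕ} [Fact p.Prime]
    (hp : Odd p) (hN : commonDenominator φ = p * M) (hpM : p.Coprime M) :
    ∃ (ψ : Fin n → ℚ) (a : Fin n → ℕ) (b : Fin n → ℚ) (α : ℂ),
      (∀ j, cosRat (ψ j) = cosRat (φ j)) ∧ IsCosSplitting p ψ a b α ∧ (∀ j, (b j).den ∣ M) ∧
        ∃ i, a i ≠ 0 := by
  have hM : M ≠ 0 := right_ne_zero_of_mul (hN ▸ commonDenominator_ne_zero φ)
  choose a b ha hb hab using fun j =>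
    exists_eq_div_add_or_neg hp hM hpM (hN ▸ den_dvd_commonDenominator φ j)
  have hcos (j : Fin n) : cosRat (a j / p + b j) = cosRat (φ j) := by
    rcases hab j with h | h <;> rw [h]
    exact cosRat_neg _
  obtain ⟨i, hi⟩ := exists_not_den_dvd (Fact.out (p := p.Prime)).one_lt hN
  obtain ⟨α, h⟩ := exists_isCosSplitting_of_eq_add hM hpM ha hb (fun j => rfl)
    (irreducibleCos_iff.1 (hφ.congr hcos)).1
  refine ⟨_, a, b, α, hcos, h, hb, i, fun h0 => hi ?_⟩
  have hbi := hab i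
  rw [h0, Nat.cast_zero, zero_div, zero_add] at hbi
  rcases hbi with hbi | hbi
  · exact hbi ▸ hb i
  · exact Rat.den_neg_eq_den (φ i) ▸ hbi ▸ hb i

namespace IsCosSplitting

variable {p : ℕ} {a : Fin n → ℕ} {b : Fin n → ℚ} {α : ℂ}

theorem expRat_eq (h : IsCosSplitting p φ a b α) (j : Fin n) :
    expRat (φ j) = expRat (a j / p) * expRat (b j) := by
  rw [h.eq_add, expRat_add]

theorem isListedCos_of_zero (h : IsCosSplitting p φ a b 0) (hφ : IrreducibleCos φ) (hn : n ≤ 6)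
    {i : Fin n} (hi : a i ≠ 0) : IsListedCos φ := by
  refine hφ.isListedCos_of_disjoint hn (S := Finset.univ.filter fun j => a j = a i)
    (Finset.disjoint_empty_right _) ⟨i, by simp⟩ ?_
  rw [Finset.sum_empty, add_zero, ← mul_zero (expRat (a i / p)),
    ← h.sum_class (a i) (Nat.pos_of_ne_zero hi) (h.two_mul_lt i), Finset.mul_sum]
  refine Finset.sum_congr rfl fun j hj => ?_
  rw [h.expRat_eq, (Finset.mem_filter.1 hj).2]

theorem exists_class (h : IsCosSplitting p φ a b α) (hα : α ≠ 0) {c : ℕ} (hc : 2 * c < p) :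
    (Finset.univ.filter fun j => a j = c).Nonempty := by
  rcases Nat.eq_zero_or_pos c with rfl | hpos
  · exact Finset.nonempty_of_sum_ne_zero (h.sum_zero ▸ hα)
  · exact Finset.nonempty_of_sum_ne_zero (h.sum_class c hpos hc ▸ hα)

theorem add_half (h : IsCosSplitting p φ a b α) :
    IsCosSplitting p (fun j => φ j + 1 / 2) a (fun j => b j + 1 / 2) (-α) where
  eq_add j := by rw [h.eq_add, add_assoc]
  two_mul_lt := h.two_mul_lt
  sum_class c hc hcp := by simp only [expRat_add_half, Finset.sum_neg_distrib, h.sum_class c hc hcp]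
  sum_zero := by
    simp only [cosRat_add_half, Complex.ofReal_neg, mul_neg, Finset.sum_neg_distrib, h.sum_zero]

theorem conj_eq (h : IsCosSplitting p φ a b α) : (starRingEnd ℂ) α = α := by
  simp only [← h.sum_zero, map_sum, map_mul, Complex.conj_ofReal, map_ofNat]

theorem exists_class_eq_singleton (h : IsCosSplitting p φ a b α) (hα : α ≠ 0) (hp : Odd p)
    (hn : n < p) :
    ∃ c, 0 < c ∧ 2 * c < p ∧ ∃ j, (Finset.univ.filter fun j => a j = c) = {j} := by
  obtain ⟨r, rfl⟩ := hp
  have hzero := (h.exists_class hα (c := 0) (by omega)).card_pos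
  have hcard := Finset.card_filter_add_card_filter_not (s := Finset.univ) fun j => a j = 0
  simp only [Finset.card_univ, Fintype.card_fin, ← ne_eq] at hcard
  obtain ⟨c, hc, hcard⟩ := Finset.exists_card_fiber_lt_of_card_lt_mul (f := a)
    (s := Finset.univ.filter fun j => a j ≠ 0) (t := Finset.Icc 1 r) (n := 2)
    (by simp only [Nat.card_Icc]; omega)
  rw [Finset.mem_Icc] at hc
  have hne := h.exists_class hα (c := c) (by omega)
  have hfilter : ((Finset.univ.filter fun j => a j ≠ 0).filter fun j => a j = c) =
      Finset.univ.filter fun j => a j = c := by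
    rw [Finset.filter_filter]
    exact Finset.filter_congr fun j _ => by omega
  rw [hfilter] at hcard
  exact ⟨c, by omega, by omega,
    Finset.card_eq_one.1 (by have := hne.card_pos; omega)⟩

/-- A nonzero class with a single member shows that `α` is a root of unity, and `α` is real. -/
theorem eq_one_or_neg_one (h : IsCosSplitting p φ a b α) (hα : α ≠ 0) (hp : Odd p) (hn : n < p) :
    α = 1 ∨ α = -1 := by
  obtain ⟨c, hc, hcp, j, hj⟩ := h.exists_class_eq_singleton hα hp hn
  have hαj := h.sum_class c hc hcp
  rw [hj, Finset.sum_singleton] at hαj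
  have hconj := h.conj_eq
  rw [← hαj, conj_expRat] at hconj
  rw [← mul_self_eq_one_iff, ← hαj]
  nth_rw 2 [← hconj]
  exact expRat_mul_expRat_neg _

theorem half_le (h : IsCosSplitting p φ a b α) (hα : α ≠ 0) : (p + 1) / 2 ≤ n := by
  have hsub : Finset.range ((p + 1) / 2) ⊆ Finset.univ.image a := fun c hc => by
    obtain ⟨j, hj⟩ := h.exists_class hα (c := c) (by have := Finset.mem_range.1 hc; omega)
    exact Finset.mem_image.2 ⟨j, Finset.mem_univ j, (Finset.mem_filter.1 hj).2⟩
  simpa using (Finset.card_le_card hsub).trans Finset.card_image_le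

end IsCosSplitting

theorem IrreducibleCos.isListedCos_or_exists_isCosSplitting_one (hφ : IrreducibleCos φ)
    (hn : n ≤ 6) {p M : ℕ} [Fact p.Prime] (hp : Odd p) (hN : commonDenominator φ = p * M)
    (hpM : p.Coprime M) (hnp : n < p) :
    IsListedCos φ ∨ ∃ (ψ : Fin n → ℚ) (a : Fin n → ℕ) (b : Fin n → ℚ), IrreducibleCos ψ ∧
      (IsListedCos ψ → IsListedCos φ) ∧ IsCosSplitting p ψ a b 1 ∧ ∀ j, (b j).den ∣ M.lcm 2 := by
  obtain ⟨ψ, a, b, α, hψ, h, hb, i, hi⟩ := hφ.exists_isCosSplitting hp hN hpM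
  have hψφ : IsListedCos ψ → IsListedCos φ := fun hlisted => hlisted.congr hψ
  rcases eq_or_ne α 0 with rfl | hα
  · exact Or.inl (hψφ (h.isListedCos_of_zero (hφ.congr hψ) hn hi))
  refine Or.inr ?_
  rcases h.eq_one_or_neg_one hα hp hnp with rfl | rfl
  · exact ⟨ψ, a, b, hφ.congr hψ, hψφ, h, fun j => (hb j).trans (Nat.dvd_lcm_left M 2)⟩
  · refine ⟨_, a, _, ?_, fun hlisted => hlisted.of_neg fun j => ?_, neg_neg (1 : ℂ) ▸ h.add_half,
      fun j => (Rat.add_den_dvd_lcm (b j) (1 / 2)).trans (lcm_dvd_lcm (hb j) (by norm_num))⟩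
    · rw [irreducibleCos_iff] at *
      simpa only [cosRat_add_half, hψ] using hφ.neg
    · simp only [cosRat_add_half, hψ]

end CosComponents

section CosClasses

variable {n : ℕ} {φ : Fin n → ℚ}

/-- The multiset of the cosines of the angles in the class `c` of a labelling of the angles. -/
noncomputable def classValues (φ : Fin n → ℚ) (a : Fin n → ℕ) (c : ℕ) : Multiset ℝ :=
  ∑ j with a j = c, {cosRat (φ j)}

theorem card_classValues (a : Fin n → ℕ) (c : ℕ) :
    (classValues φ a c).card = (Finset.univ.filter fun j => a j = c).card := by
  simp [classValues]

theorem sum_classValues {r : ℕ} {a : Fin n → ℕ} (h : ∀ j, a j < r) :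
    ∑ c ∈ Finset.range r, classValues φ a c = cosMultiset φ :=
  Finset.sum_fiberwise_of_maps_to (fun j _ => Finset.mem_range.2 (h j)) _

theorem sum_card_classValues {r : ℕ} {a : Fin n → ℕ} (h : ∀ j, a j < r) :
    ∑ c ∈ Finset.range r, (classValues φ a c).card = n := by
  simpa [cosMultiset] using congrArg Multiset.card (sum_classValues (φ := φ) h)

theorem isListedCos_of_matchesSome {x : List ℚ} (hφ : cosMultiset φ = x.map cosRat)
    (h : matchesSome (cosSporadic n) x = true) : IsListedCos φ := by
  obtain ⟨ψ, hψ, heq⟩ := exists_of_matchesSome h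
  exact Or.inl ⟨ψ, hψ, cosEquiv_iff.2 (Or.inl (hφ.trans heq.symm))⟩

theorem expRat_eq_neg_of_add_add_eq_one {x y z : ℚ} (h : expRat x + expRat y + expRat z = 1) :
    expRat y + expRat z = 0 ∨ expRat x + expRat z = 0 ∨ expRat x + expRat y = 0 := by
  have hconj : expRat (-x) + expRat (-y) + expRat (-z) = 1 := by
    rw [← conj_expRat, ← conj_expRat, ← conj_expRat, ← map_add, ← map_add, h, map_one]
  have hx := expRat_mul_expRat_neg x
  have hy := expRat_mul_expRat_neg y
  have hz := expRat_mul_expRat_neg z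
  have esymm_eq : expRat y * expRat z + expRat x * expRat z + expRat x * expRat y =
      expRat x * expRat y * expRat z := by
    linear_combination expRat x * expRat y * expRat z * hconj - expRat y * expRat z * hx -
      expRat x * expRat z * hy - expRat x * expRat y * hz
  have hroot : (1 - expRat x) * ((1 - expRat y) * (1 - expRat z)) = 0 := by
    linear_combination esymm_eq - h
  simp only [mul_eq_zero] at hroot
  rcases hroot with hroot | hroot | hroot
  · exact Or.inl (by linear_combination h + hroot)
  · exact Or.inr (Or.inl (by linear_combination h + hroot))
  · exact Or.inr (Or.inr (by linear_combination h + hroot))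

namespace IsCosSplitting

variable {p : ℕ} {a : Fin n → ℕ} {b : Fin n → ℚ}

theorem cosRat_eq_of_expRat_eq {α : ℂ} (h : IsCosSplitting p φ a b α) {j : Fin n} {z : ℚ}
    (hz : expRat (b j) = expRat z) : cosRat (φ j) = cosRat (a j / p + z) := by
  rw [← expRat_re, h.expRat_eq, hz, ← expRat_add, expRat_re]

theorem card_classValues_pos (h : IsCosSplitting p φ a b 1) {c : ℕ} (hcp : 2 * c < p) :
    0 < (classValues φ a c).card :=
  card_classValues a c ▸ (h.exists_class one_ne_zero hcp).card_pos

theorem classValues_of_card_eq_one (h : IsCosSplitting p φ a b 1) {c : ℕ} (hc : 0 < c)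
    (hcp : 2 * c < p) (hcard : (classValues φ a c).card = 1) :
    classValues φ a c = {cosRat (c / p)} := by
  rw [card_classValues] at hcard
  obtain ⟨j, hj⟩ := Finset.card_eq_one.1 hcard
  have hb := h.sum_class c hc hcp
  have haj : a j = c := (Finset.mem_filter.1 (hj.ge (Finset.mem_singleton_self j))).2
  rw [hj, Finset.sum_singleton, ← expRat_zero] at hb
  rw [classValues, hj, Finset.sum_singleton, h.cosRat_eq_of_expRat_eq hb, haj, add_zero]

theorem classValues_zero_of_card_eq_one (h : IsCosSplitting p φ a b 1)
    (hcard : (classValues φ a 0).card = 1) : classValues φ a 0 = {cosRat (1 / 6)} := by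
  rw [card_classValues] at hcard
  obtain ⟨j, hj⟩ := Finset.card_eq_one.1 hcard
  have hb := h.sum_zero
  have haj : a j = 0 := (Finset.mem_filter.1 (hj.ge (Finset.mem_singleton_self j))).2
  rw [hj, Finset.sum_singleton] at hb
  replace hb : 2 * cosRat (b j) = 1 := by exact_mod_cast hb
  rw [classValues, hj, Finset.sum_singleton, h.eq_add, haj, Nat.cast_zero, zero_div, zero_add,
    cosRat_sixth, ← hb, mul_div_cancel_left₀ _ two_ne_zero]

theorem classValues_of_card_eq_two (h : IsCosSplitting p φ a b 1) {c : ℕ} (hc : 0 < c)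
    (hcp : 2 * c < p) (hcard : (classValues φ a c).card = 2) :
    classValues φ a c = {cosRat (c / p + 1 / 6), cosRat (c / p - 1 / 6)} := by
  rw [card_classValues] at hcard
  obtain ⟨i, j, hij, hS⟩ := Finset.card_eq_two.1 hcard
  have hb := h.sum_class c hc hcp
  have hai : a i = c := (Finset.mem_filter.1 (hS.ge (Finset.mem_insert_self i {j}))).2
  have haj : a j = c := (Finset.mem_filter.1 (hS.ge (by simp))).2
  rw [hS, Finset.sum_pair hij] at hb
  rw [classValues, hS, Finset.sum_pair hij, Multiset.singleton_add, sub_eq_add_neg]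
  rcases expRat_add_eq_one hb with ⟨hi, hj⟩ | ⟨hi, hj⟩
  · rw [h.cosRat_eq_of_expRat_eq hi, h.cosRat_eq_of_expRat_eq hj, hai, haj]
    rfl
  · rw [h.cosRat_eq_of_expRat_eq hi, h.cosRat_eq_of_expRat_eq hj, hai, haj]
    exact Multiset.pair_comm _ _

theorem card_classValues_ne_three (h : IsCosSplitting p φ a b 1) (hφ : IrreducibleCos φ)
    {c : ℕ} (hc : 0 < c) (hcp : 2 * c < p) : (classValues φ a c).card ≠ 3 := by
  intro hcard
  rw [card_classValues] at hcard
  have hn : 3 ≤ n := by simpa [hcard] using card_finset_fin_le (Finset.univ.filter fun j => a j = c)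
  have hb := h.sum_class c hc hcp
  have cancel_free {i j : Fin n} (hij : i ≠ j) (hi : a i = c) (hj : a j = c) :
      expRat (b i) + expRat (b j) ≠ 0 := fun h0 => by
    have hsum : ∑ l ∈ {i, j}, cosRat (φ l) = 0 := by
      rw [Finset.sum_pair hij, ← expRat_re, ← expRat_re, ← Complex.add_re, h.expRat_eq,
        h.expRat_eq, hi, hj, ← mul_add, h0, mul_zero, Complex.zero_re]
    have huniv := congrArg Finset.card
      ((irreducibleCos_iff.1 hφ).eq_univ ⟨i, Finset.mem_insert_self i {j}⟩ hsum)
    rw [Finset.card_pair hij, Finset.card_univ, Fintype.card_fin] at huniv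
    omega
  obtain ⟨i, j, k, hij, hik, hjk, hS⟩ := Finset.card_eq_three.1 hcard
  have mem (l : Fin n) (hl : l ∈ ({i, j, k} : Finset (Fin n))) : a l = c :=
    (Finset.mem_filter.1 (hS.ge hl)).2
  rw [hS, Finset.sum_insert (by simp [hij, hik]), Finset.sum_pair hjk, ← add_assoc] at hb
  rcases expRat_eq_neg_of_add_add_eq_one hb with h0 | h0 | h0
  · exact cancel_free hjk (mem j (by simp)) (mem k (by simp)) h0
  · exact cancel_free hik (mem i (by simp)) (mem k (by simp)) h0
  · exact cancel_free hij (mem i (by simp)) (mem j (by simp)) h0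

theorem isListedCos_eleven (h : IsCosSplitting 11 φ a b 1) (hn : n ≤ 6) : IsListedCos φ := by
  have ha (j : Fin n) : a j < 6 := by
    have := h.two_mul_lt j
    omega
  have hsum := sum_classValues (φ := φ) ha
  have hcard := sum_card_classValues (φ := φ) ha
  simp only [Finset.sum_range_succ, Finset.sum_range_zero, zero_add] at hcard hsum
  have pos (c : ℕ) (hc : c < 6) := h.card_classValues_pos (c := c) (by omega)
  have card_eq_one (c : ℕ) (hc : c < 6) : (classValues φ a c).card = 1 := by
    have := pos 0
    have := pos 1
    have := pos 2
    have := pos 3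
    have := pos 4
    have := pos 5
    interval_cases c <;> omega
  have value (c : ℕ) (hc : c < 6) (hc0 : 0 < c) : classValues φ a c = {cosRat (c / 11)} :=
    h.classValues_of_card_eq_one hc0 (by omega) (card_eq_one c hc)
  simp only [card_eq_one, Nat.reduceLT, Nat.reduceAdd] at hcard
  subst hcard
  refine isListedCos_of_matchesSome (x := [1 / 6, 1 / 11, 2 / 11, 3 / 11, 4 / 11, 5 / 11]) ?_
    (by decide +kernel)
  rw [← hsum, h.classValues_zero_of_card_eq_one (card_eq_one 0 (by norm_num)), value 1, value 2,
    value 3, value 4, value 5]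
  · simp
    rfl
  all_goals norm_num

end IsCosSplitting

end CosClasses

section HalfSolutions

variable {ι : Type*}

/-- Numerators over `60` of the solutions of `∑ cos = 1/2` that have at most 3 terms and no
vanishing part. -/
def halfSolutions : List (List ℕ) :=
  [[10], [6, 18], [0, 20], [4, 16, 18], [0, 12, 24], [6, 8, 28]]

/-- Whether `l` contains a short solution of the cosine equation or is a permutation of a solution
of `∑ cos = 1/2`. -/
def isReducibleOrHalf (l : List ℕ) : Bool :=
  (shortSolutions.any fun b => isSubmultiset b l) || halfSolutions.any fun a => l.isPerm a

theorem checkSums_isReducibleOrHalf : ∀ n ∈ [1, 2, 3],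
    checkSums 9241 sixtyResidue isReducibleOrHalf n (List.range 31)
      (({20} : Multiset ℕ).map sixtyResidue).sum [] = true := by
  decide +kernel

theorem exists_halfSolutions {s : Finset ι} (hs : s.Nonempty) (hs3 : s.card ≤ 3) {x : ι → ℚ}
    (hx : ∀ i, (x i).den ∣ 60) (hsum : ∑ i ∈ s, cosRat (x i) = 1 / 2)
    (hne : ∀ E ⊆ s, E.Nonempty → ∑ i ∈ E, cosRat (x i) ≠ 0) :
    ∃ l ∈ halfSolutions,
      ∑ i ∈ s, ({cosRat (x i)} : Multiset ℝ) = l.map fun k : ℕ => cosRat (k / 60) := by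
  choose K hK using fun i => den_dvd_iff.1 (hx i)
  choose k hk_le _ hk using fun i => exists_numerator_sixty (hK i)
  obtain ⟨l, hl, hgood⟩ := exists_good_of_sum_cosRat_eq_zero
    (checkSums_isReducibleOrHalf s.card (by have := hs.card_pos; simp only [List.mem_cons]; omega))
    (m := ∑ i ∈ s, {k i}) (by simp)
    (fun y hy => by
      simp only [Multiset.mem_sum, Multiset.mem_singleton] at hy
      obtain ⟨i, -, rfl⟩ := hy
      exact List.mem_range.2 (Nat.lt_succ_of_le (hk_le i)))
    (by
      simp only [Multiset.map_add, Multiset.sum_add, sum_singleton_eq_map, Multiset.map_map,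
        Function.comp_def, hk, Multiset.map_singleton, Multiset.sum_singleton, Nat.cast_ofNat]
      have hthird := cosRat_third
      norm_num at hthird ⊢
      rw [hthird, hsum]
      norm_num)
  simp only [isReducibleOrHalf, Bool.or_eq_true, List.any_eq_true] at hgood
  rcases hgood with ⟨b, hb, hbl⟩ | ⟨l', hl', hperm⟩
  · obtain ⟨E, hE, hEne, -, h0⟩ := exists_sum_cosRat_eq_zero_of_shortSolutions hb hbl hl
    exact absurd (by simpa only [hk] using h0) (hne E hE hEne)
  · refine ⟨l', hl', ?_⟩
    rw [← Multiset.map_coe, ← Multiset.coe_eq_coe.2 (List.isPerm_iff.1 hperm), hl,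
      map_sum_singleton]
    simp only [hk]

end HalfSolutions

section PrimeSeven

variable {n : ℕ} {φ : Fin n → ℚ} {a : Fin n → ℕ} {b : Fin n → ℚ}

/-- The possible angles of the class `c` modulo `7`. -/
def classAngles (c : ℕ) : List (List ℚ) := [[c / 7], [c / 7 + 1 / 6, c / 7 - 1 / 6]]

theorem matchesSome_cosSporadic_seven :
    ∀ l₀ ∈ halfSolutions, ∀ l₁ ∈ classAngles 1, ∀ l₂ ∈ classAngles 2, ∀ l₃ ∈ classAngles 3,
      l₀.length + l₁.length + l₂.length + l₃.length ≤ 6 →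
        matchesSome (cosSporadic (l₀.length + l₁.length + l₂.length + l₃.length))
          ((l₀.map fun k : ℕ => (k / 60 : ℚ)) ++ l₁ ++ l₂ ++ l₃) = true := by
  decide +kernel

namespace IsCosSplitting

theorem exists_classAngles (h : IsCosSplitting 7 φ a b 1) (hφ : IrreducibleCos φ) {c : ℕ}
    (hc : 0 < c) (hc7 : 2 * c < 7) (hcard : (classValues φ a c).card ≤ 3) :
    ∃ l ∈ classAngles c, classValues φ a c = l.map cosRat := by
  have hpos := h.card_classValues_pos hc7
  have hne := h.card_classValues_ne_three hφ hc hc7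
  obtain hone | htwo : (classValues φ a c).card = 1 ∨ (classValues φ a c).card = 2 := by omega
  · exact ⟨_, List.mem_cons_self, h.classValues_of_card_eq_one hc hc7 hone⟩
  · exact ⟨_, List.mem_cons_of_mem _ List.mem_cons_self, h.classValues_of_card_eq_two hc hc7 htwo⟩

theorem exists_halfSolutions (h : IsCosSplitting 7 φ a b 1) (hφ : IrreducibleCos φ)
    (hb : ∀ j, (b j).den ∣ 60) (hn : 3 < n) (hcard : (classValues φ a 0).card ≤ 3) :
    ∃ l ∈ halfSolutions, classValues φ a 0 = (l.map fun k : ℕ => (k / 60 : ℚ)).map cosRat := by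
  rw [card_classValues] at hcard
  have hφb {j : Fin n} (hj : a j = 0) : cosRat (b j) = cosRat (φ j) := by
    rw [h.eq_add, hj, Nat.cast_zero, zero_div, zero_add]
  have hsum : 2 * ∑ j with a j = 0, cosRat (b j) = 1 := by
    rw [Finset.mul_sum]
    exact_mod_cast h.sum_zero
  obtain ⟨l, hl, heq⟩ := _root_.exists_halfSolutions (h.exists_class one_ne_zero (by norm_num))
    hcard hb (by linarith) fun E hE hEne h0 => by
      have hE_card := Finset.card_le_card hE
      rw [Finset.sum_congr rfl fun j hj => hφb (Finset.mem_filter.1 (hE hj)).2] at h0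
      rw [(irreducibleCos_iff.1 hφ).eq_univ hEne h0, Finset.card_univ, Fintype.card_fin] at hE_card
      omega
  refine ⟨l, hl, ?_⟩
  rw [List.map_map]
  refine Eq.trans (Finset.sum_congr rfl fun j hj => ?_) heq
  rw [hφb (Finset.mem_filter.1 hj).2]

theorem isListedCos_seven (h : IsCosSplitting 7 φ a b 1) (hφ : IrreducibleCos φ) (hn : n ≤ 6)
    (hb : ∀ j, (b j).den ∣ 60) : IsListedCos φ := by
  have ha (j : Fin n) : a j < 4 := by
    have := h.two_mul_lt j
    omega
  have hsum := sum_classValues (φ := φ) ha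
  have hcard := sum_card_classValues (φ := φ) ha
  simp only [Finset.sum_range_succ, Finset.sum_range_zero, zero_add] at hcard hsum
  have := h.card_classValues_pos (c := 0) (by norm_num)
  have := h.card_classValues_pos (c := 1) (by norm_num)
  have := h.card_classValues_pos (c := 2) (by norm_num)
  have := h.card_classValues_pos (c := 3) (by norm_num)
  obtain ⟨l₀, hl₀, h₀⟩ := h.exists_halfSolutions hφ hb (by omega) (by omega)
  obtain ⟨l₁, hl₁, h₁⟩ :=
    h.exists_classAngles hφ (c := 1) (by omega) (by omega) (by omega)
  obtain ⟨l₂, hl₂, h₂⟩ :=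
    h.exists_classAngles hφ (c := 2) (by omega) (by omega) (by omega)
  obtain ⟨l₃, hl₃, h₃⟩ :=
    h.exists_classAngles hφ (c := 3) (by omega) (by omega) (by omega)
  simp only [h₀, h₁, h₂, h₃, Multiset.coe_card, List.length_map] at hcard
  subst hcard
  refine isListedCos_of_matchesSome ?_
    (matchesSome_cosSporadic_seven l₀ hl₀ l₁ hl₁ l₂ hl₂ l₃ hl₃ hn)
  simp only [← hsum, h₀, h₁, h₂, h₃, Multiset.coe_add, List.map_append]

end IsCosSplitting

end PrimeSeven

section CosEquation

variable {n : ℕ} {φ : Fin n → ℚ}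

theorem IrreducibleCos.isListedCos_of_eleven_le (hφ : IrreducibleCos φ) (hn : n ≤ 6) {p : ℕ}
    (hp : p.Prime) (hp11 : 11 ≤ p) (hd : p ∣ commonDenominator φ)
    (hsq : ¬ p * p ∣ commonDenominator φ) : IsListedCos φ := by
  have : Fact p.Prime := ⟨hp⟩
  obtain ⟨M, hM⟩ := hd
  have hpM : p.Coprime M := hp.coprime_iff_not_dvd.2 fun h => hsq (hM ▸ Nat.mul_dvd_mul_left p h)
  rcases hφ.isListedCos_or_exists_isCosSplitting_one hn (hp.odd_of_ne_two (by omega)) hM hpM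
    (by omega) with hlisted | ⟨ψ, a, b, -, hψφ, h, -⟩
  · exact hlisted
  have hle := h.half_le one_ne_zero
  obtain rfl | rfl : p = 11 ∨ p = 12 := by omega
  · exact hψφ (h.isListedCos_eleven hn)
  · exact absurd hp (by norm_num)

theorem IrreducibleCos.isListedCos_of_seven_mul (hφ : IrreducibleCos φ) (hn : n ≤ 6) {M : ℕ}
    (hN : commonDenominator φ = 7 * M) (hM : M ∣ 60) : IsListedCos φ := by
  have : Fact (Nat.Prime 7) := ⟨by norm_num⟩
  have h7M : Nat.Coprime 7 M := Nat.Coprime.coprime_dvd_right hM (by norm_num)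
  rcases hφ.isListedCos_or_exists_isCosSplitting_one hn (by decide) hN h7M (by omega) with
    hlisted | ⟨ψ, a, b, hψ, hψφ, h, hb⟩
  · exact hlisted
  · exact hψφ (h.isListedCos_seven hψ hn fun j => (hb j).trans (Nat.lcm_dvd hM (by norm_num)))

theorem IrreducibleCos.isListedCos_of_dvd_sixty (hφ : IrreducibleCos φ) (hn : 1 < n)
    (hn6 : n ≤ 6) (hd : commonDenominator φ ∣ 60) : IsListedCos φ := by
  choose k hk using fun j => den_dvd_iff.1 (den_dvd_commonDenominator φ j)
  have hodd := hφ.odd_numerator_of_four_dvd hk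
  obtain ⟨m, hm⟩ := hd
  refine hφ.isListedCos_of_denominator_sixty hn hn6 (K := fun j => k j * m) (fun j => ?_) ?_
  · rw [Int.cast_mul, ← hk j, mul_assoc]
    exact_mod_cast congrArg (φ j * ·) (congrArg (Nat.cast (R := ℚ)) hm)
  rcases Nat.even_or_odd m with even | odd
  · exact Or.inl fun j => ((Int.even_coe_nat m).2 even).mul_left (k j)
  · have hcoprime : Nat.Coprime 4 m := odd.coprime_two_left.pow_left 2
    have h4 : 4 ∣ commonDenominator φ := hcoprime.dvd_of_dvd_mul_right (hm ▸ by norm_num)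
    exact Or.inr fun j => (hodd h4 j).mul ((Int.odd_coe_nat m).2 odd)

theorem dvd_of_forall_odd_sq_not_dvd {N K : ℕ} (hsq : ∀ p, p.Prime → p ≠ 2 → ¬ p * p ∣ N)
    (h8 : ¬ 8 ∣ N) (hK4 : 2 ^ 2 ∣ K) (hK : ∀ p, p.Prime → p ∣ N → p ∣ K) : N ∣ K := by
  rw [Nat.dvd_iff_prime_pow_dvd_dvd]
  intro p k hp hd
  rcases k with _ | _ | k
  · exact one_dvd K
  · rw [zero_add, pow_one] at hd ⊢
    exact hK p hp hd
  obtain rfl : p = 2 := by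
    by_contra hp2
    exact hsq p hp hp2 ((sq p ▸ pow_dvd_pow p (Nat.le_add_left 2 k)).trans hd)
  obtain rfl : k = 0 := by
    by_contra hk
    exact h8 ((pow_dvd_pow 2 (by omega : 3 ≤ k + 1 + 1)).trans hd)
  exact hK4

theorem IrreducibleCos.isListedCos (hφ : IrreducibleCos φ) (hn : 1 < n) (hn6 : n ≤ 6) :
    IsListedCos φ := by
  by_contra hnot
  have hsq (p : ℕ) (hp : p.Prime) (hp2 : p ≠ 2) : ¬ p * p ∣ commonDenominator φ := fun hd =>
    hnot (hφ.isListedCos_of_odd_sq_dvd hn6 hp hp2 hd)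
  have hprime (p : ℕ) (hp : p.Prime) (hd : p ∣ commonDenominator φ) :
      p = 2 ∨ p = 3 ∨ p = 5 ∨ p = 7 := by
    have hp11 : p < 11 := by
      by_contra! hp11
      exact hnot (hφ.isListedCos_of_eleven_le hn6 hp hp11 hd (hsq p hp (by omega)))
    interval_cases p <;> first | omega | exact absurd hp (by norm_num)
  have hdvd {K : ℕ} : 2 ^ 2 ∣ K → (∀ p, p.Prime → p ∣ commonDenominator φ → p ∣ K) →
      commonDenominator φ ∣ K :=
    dvd_of_forall_odd_sq_not_dvd hsq fun h8 => hnot (hφ.isListedCos_of_eight_dvd hn6 h8)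
  by_cases h7 : 7 ∣ commonDenominator φ
  · have h420 : commonDenominator φ ∣ 420 := hdvd (by norm_num) fun p hp hd => by
      rcases hprime p hp hd with rfl | rfl | rfl | rfl <;> norm_num
    obtain ⟨M, hM⟩ := h7
    rw [hM] at h420
    exact hnot (hφ.isListedCos_of_seven_mul hn6 hM
      (Nat.dvd_of_mul_dvd_mul_left (by norm_num) (h420 : 7 * M ∣ 7 * 60)))
  · refine hnot (hφ.isListedCos_of_dvd_sixty hn hn6 (hdvd (by norm_num) fun p hp hd => ?_))
    rcases hprime p hp hd with rfl | rfl | rfl | rfl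
    · norm_num
    · norm_num
    · norm_num
    · exact absurd hd h7

end CosEquation

section ListedExp

variable {n : ℕ} {F : ℚ → Fin n → ℚ}

/-- The numerator over `4620` of a nonnegative rational number. -/
def numerator (x : ℚ) : ℕ := (x * 4620).num.toNat

theorem IrreducibleExp.add_const {φ : Fin n → ℚ} (hφ : IrreducibleExp φ) (c : ℚ) :
    IrreducibleExp fun j => φ j + c := by
  simp only [irreducibleExp_iff, expRat_add, mul_comm _ (expRat c)] at *
  exact hφ.const_mul (expRat_ne_zero c)

theorem sum_expResidue_mod_ne_zero (hF : F ∈ expFamilies n) : ∀ E : Finset (Fin n),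
    E.Nonempty → E ≠ Finset.univ → (∑ j ∈ E, expResidue (numerator (F (1 / 6) j))) % 9241 ≠ 0 := by
  apply forall_mem_expFamilies ?_ ?_ ?_ ?_ F hF <;> decide +kernel

theorem irreducibleExp_expFamilies (hF : F ∈ expFamilies n) (θ : ℚ) : IrreducibleExp (F θ) := by
  have hnum : ∀ j, F (1 / 6) j = numerator (F (1 / 6) j) / 4620 := by
    apply forall_mem_expFamilies ?_ ?_ ?_ ?_ F hF <;> decide +kernel
  have hbase : IrreducibleExp (F (1 / 6)) := by
    refine ⟨sum_expFamilies hF _, fun E hE hne hsum => ?_⟩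
    refine sum_expResidue_mod_ne_zero hF E hE hne (sum_expResidue_mod ?_)
    simp only [← hnum]
    exact hsum
  simpa only [← expFamilies_add hF, add_sub_cancel] using hbase.add_const (θ - 1 / 6)

theorem IsListedExp.irreducibleExp {φ : Fin n → ℚ} (h : IsListedExp φ) : IrreducibleExp φ := by
  obtain ⟨F, hF, θ, hφ⟩ := h
  have hF_irr := irreducibleExp_iff.1 (irreducibleExp_expFamilies hF θ)
  exact hF_irr.of_sum_singleton_eq (expEquiv_iff.1 hφ)

end ListedExp

section Sporadic

variable {n : ℕ} {ψ : Fin n → ℚ}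

theorem sum_cosRat_of_matchesSome {x : List ℚ} (h : matchesSome [ψ] x = true) :
    ∑ j, cosRat (ψ j) = (x.map cosRat).sum := by
  obtain ⟨_, hmem, hx⟩ := exists_of_matchesSome h
  rw [← sum_cosMultiset, ← List.mem_singleton.1 hmem, hx, Multiset.sum_coe]

theorem cosRat_seventh_add : cosRat (1 / 7) + cosRat (2 / 7) + cosRat (3 / 7) = -1 / 2 := by
  have hsum := sum_range_cosRat_add_div (p := 7) (by norm_num) 0
  have fold₁ := cosRat_one_sub (1 / 7)
  have fold₂ := cosRat_one_sub (2 / 7)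
  have fold₃ := cosRat_one_sub (3 / 7)
  norm_num [Finset.sum_range_succ, cosRat_zero] at hsum fold₁ fold₂ fold₃ ⊢
  linarith

theorem cosRat_eleventh_add : cosRat (1 / 11) + cosRat (2 / 11) + cosRat (3 / 11) +
    cosRat (4 / 11) + cosRat (5 / 11) = -1 / 2 := by
  have hsum := sum_range_cosRat_add_div (p := 11) (by norm_num) 0
  have fold₁ := cosRat_one_sub (1 / 11)
  have fold₂ := cosRat_one_sub (2 / 11)
  have fold₃ := cosRat_one_sub (3 / 11)
  have fold₄ := cosRat_one_sub (4 / 11)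
  have fold₅ := cosRat_one_sub (5 / 11)
  norm_num [Finset.sum_range_succ, cosRat_zero] at hsum fold₁ fold₂ fold₃ fold₄ fold₅ ⊢
  linarith

theorem sum_halfSolutions {l : List ℕ} (hl : l ∈ halfSolutions) :
    (l.map fun k : ℕ => cosRat (k / 60)).sum = 1 / 2 := by
  have fifths := cosRat_fifth_add
  have tenths := cosRat_tenth_add
  have reflect₁ := cosRat_half_sub (1 / 5)
  have reflect₂ := cosRat_half_sub (2 / 5)
  simp only [halfSolutions, List.mem_cons, List.not_mem_nil, or_false] at hl
  rcases hl with rfl | rfl | rfl | rfl | rfl | rfl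
  · have sixth := cosRat_sixth
    norm_num at sixth ⊢
    exact sixth
  · norm_num at tenths ⊢
    exact tenths
  · have third := cosRat_third
    norm_num [cosRat_zero] at third ⊢
    linarith
  · have hsum := sum_range_cosRat_add_div (p := 3) (by norm_num) (1 / 15)
    have fold := cosRat_one_sub (4 / 15)
    norm_num [Finset.sum_range_succ] at hsum fold fifths reflect₁ ⊢
    linarith
  · norm_num [cosRat_zero] at fifths ⊢
    linarith
  · have hsum := sum_range_cosRat_add_div (p := 3) (by norm_num) (2 / 15)
    have fold := cosRat_one_sub (1 / 5)
    norm_num [Finset.sum_range_succ] at hsum fold fifths reflect₂ ⊢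
    linarith

theorem sum_classAngles {c : ℕ} {l : List ℚ} (hl : l ∈ classAngles c) :
    (l.map cosRat).sum = cosRat (c / 7) := by
  have sixths (x : ℚ) : cosRat (x + 1 / 6) + cosRat (x - 1 / 6) = cosRat x := by
    simp only [← expRat_re, ← Complex.add_re, sub_eq_add_neg, expRat_add, ← mul_add,
      expRat_sixth_pair, mul_one]
  simp only [classAngles, List.mem_cons, List.not_mem_nil, or_false] at hl
  rcases hl with rfl | rfl
  · simp
  · simp only [List.map_cons, List.map_nil, List.sum_cons, List.sum_nil, add_zero, sixths]

theorem cosSporadic_decomposition : ∀ n ≤ 6, ∀ ψ ∈ cosSporadic n,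
    (∃ l ∈ halfSolutions, ∃ l' ∈ halfSolutions, matchesSome [ψ]
      (l.map (fun k : ℕ => (k / 60 : ℚ)) ++ l'.map fun k : ℕ => (1 / 2 - k / 60 : ℚ)) = true) ∨
    (∃ l₀ ∈ halfSolutions, ∃ l₁ ∈ classAngles 1, ∃ l₂ ∈ classAngles 2, ∃ l₃ ∈ classAngles 3,
      matchesSome [ψ] (l₀.map (fun k : ℕ => (k / 60 : ℚ)) ++ l₁ ++ l₂ ++ l₃) = true) ∨
    matchesSome [ψ] [1 / 6, 1 / 11, 2 / 11, 3 / 11, 4 / 11, 5 / 11] = true := by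
  decide +kernel

theorem sum_cosRat_cosSporadic (hn : n ≤ 6) (hψ : ψ ∈ cosSporadic n) :
    ∑ j, cosRat (ψ j) = 0 := by
  rcases cosSporadic_decomposition n hn ψ hψ with
    ⟨l, hl, l', hl', h⟩ | ⟨l₀, hl₀, l₁, hl₁, l₂, hl₂, l₃, hl₃, h⟩ | h
  · rw [sum_cosRat_of_matchesSome h, List.map_append, List.sum_append, List.map_map, List.map_map]
    simp only [Function.comp_def, cosRat_half_sub, ← neg_one_mul (cosRat _), List.sum_map_mul_left,
      sum_halfSolutions hl, sum_halfSolutions hl']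
    norm_num
  · simp only [sum_cosRat_of_matchesSome h, List.map_append, List.sum_append, List.map_map,
      Function.comp_def, sum_halfSolutions hl₀, sum_classAngles hl₁, sum_classAngles hl₂,
      sum_classAngles hl₃]
    push_cast
    linear_combination cosRat_seventh_add
  · rw [sum_cosRat_of_matchesSome h]
    simp only [List.map_cons, List.map_nil, List.sum_cons, List.sum_nil]
    linear_combination cosRat_sixth + cosRat_eleventh_add

theorem sum_cosResidue_mod_ne_zero : ∀ n ≤ 6, ∀ ψ ∈ cosSporadic n, ∀ E : Finset (Fin n),
    E.Nonempty → E ≠ Finset.univ →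
      (∑ j ∈ E, cosResidue (numerator (foldRat (ψ j)))) % 9241 ≠ 0 := by
  decide +kernel

theorem foldRat_cosSporadic_eq_numerator_div : ∀ n ≤ 6, ∀ ψ ∈ cosSporadic n, ∀ j,
    foldRat (ψ j) = numerator (foldRat (ψ j)) / 4620 := by
  decide +kernel

theorem irreducibleCos_cosSporadic (hn : n ≤ 6) (hψ : ψ ∈ cosSporadic n) : IrreducibleCos ψ := by
  refine ⟨sum_cosRat_cosSporadic hn hψ, fun E hE hne hsum => ?_⟩
  refine sum_cosResidue_mod_ne_zero n hn ψ hψ E hE hne (sum_cosResidue_mod ?_)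
  simp only [← foldRat_cosSporadic_eq_numerator_div n hn ψ hψ, cosRat_foldRat]
  exact hsum

end Sporadic

section Inequivalence

variable {n : ℕ} {φ ψ : Fin n → ℚ}

theorem foldRat_eq_of_cosRat_eq {x y : ℚ} (h : cosRat x = cosRat y) : foldRat x = foldRat y := by
  have foldRat_le {x y : ℚ} (h : cosRat x = cosRat y) : foldRat x ≤ foldRat y := by
    rcases cosRat_eq_iff.1 h with ⟨m, hm⟩ | ⟨m, hm⟩
    · refine (round_le x (round y + m)).trans_eq (congrArg abs ?_)
      push_cast
      linear_combination hm
    · refine (round_le x (1 - round y + m)).trans_eq ?_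
      rw [foldRat, ← abs_neg]
      congr 1
      push_cast
      linear_combination -hm
  exact (foldRat_le h).antisymm (foldRat_le h.symm)

theorem matchesSome_of_cosMultiset_eq (h : cosMultiset ψ = cosMultiset φ) :
    matchesSome [ψ] (List.ofFn φ) = true := by
  obtain ⟨σ, hσ⟩ := exists_perm_of_sum_singleton_eq h
  have hψ : List.ofFn (foldRat ∘ ψ) = List.ofFn ((foldRat ∘ φ) ∘ σ) :=
    congrArg List.ofFn (funext fun j => foldRat_eq_of_cosRat_eq (hσ j))
  simp only [matchesSome, List.any_cons, List.any_nil, Bool.or_false, List.map_ofFn, hψ]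
  exact List.isPerm_iff.2 (σ.ofFn_comp_perm _)

theorem CosEquiv.matchesSome (h : CosEquiv ψ φ) :
    matchesSome [ψ] (List.ofFn φ) = true ∨
      matchesSome [fun j => 1 / 2 - ψ j] (List.ofFn φ) = true := by
  rw [cosEquiv_iff, ← cosMultiset_half_sub] at h
  exact h.imp (fun h => matchesSome_of_cosMultiset_eq h.symm)
    fun h => matchesSome_of_cosMultiset_eq h.symm

theorem matchesSome_cosSporadic_pairwise : ∀ n ≤ 6, (cosSporadic n).Pairwise fun ψ ψ' =>
    ¬ (matchesSome [ψ] (List.ofFn ψ') = true ∨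
      matchesSome [fun j => 1 / 2 - ψ j] (List.ofFn ψ') = true) := by
  decide +kernel

theorem cosSporadic_pairwise_not_cosEquiv (hn : n ≤ 6) :
    (cosSporadic n).Pairwise fun ψ ψ' => ¬ CosEquiv ψ ψ' :=
  (matchesSome_cosSporadic_pairwise n hn).imp fun h hequiv => h hequiv.matchesSome

theorem matchesSome_expFamilies_cosSporadic : ∀ n ≤ 6, ∀ ψ ∈ cosSporadic n,
    ∀ F ∈ expFamilies n, ∃ i, ∀ j, ∀ x ∈ [ψ j, -ψ j],
      matchesSome [F (x - F 0 i)] (List.ofFn ψ) = false := by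
  decide +kernel

theorem expFamilies_cosMultiset_ne (hn : n ≤ 6) (hψ : ψ ∈ cosSporadic n) {F : ℚ → Fin n → ℚ}
    (hF : F ∈ expFamilies n) (θ : ℚ) : cosMultiset (F θ) ≠ cosMultiset ψ := by
  intro h
  obtain ⟨i, hi⟩ := matchesSome_expFamilies_cosSporadic n hn ψ hψ F hF
  obtain ⟨σ, hσ⟩ := exists_perm_of_sum_singleton_eq h
  obtain ⟨x, hx, m, hm⟩ : ∃ x ∈ [ψ (σ i), -ψ (σ i)], ∃ m : ℤ, θ = x - F 0 i + m := by
    have hθ : F θ i = F 0 i + θ := by rw [← expFamilies_add hF, zero_add]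
    rcases cosRat_eq_iff.1 (hσ i) with ⟨m, hm⟩ | ⟨m, hm⟩
    · exact ⟨ψ (σ i), by simp, m, by linear_combination hm - hθ⟩
    · exact ⟨-ψ (σ i), by simp, m + 1, by push_cast; linear_combination hm - hθ⟩
  have hperiod : cosMultiset (F (x - F 0 i)) = cosMultiset (F θ) := by
    simp only [cosMultiset, hm, expFamilies_add hF _ (m : ℚ), cosRat_add_intCast]
  exact absurd (matchesSome_of_cosMultiset_eq (hperiod.trans h)) (by rw [hi _ x hx]; simp)

end Inequivalence

section CosFamilies

variable {n : ℕ} {φ ψ : Fin n → ℚ} {G : ℚ → Fin n → ℚ}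

theorem exists_expFamilies_cosMultiset_eq (hG : G ∈ cosFamilies n) :
    ∃ F ∈ expFamilies n, ∀ θ, cosMultiset (G θ) = cosMultiset (F θ) := by
  have hmem := List.mem_map_of_mem (f := fun G θ => cosMultiset (G θ)) hG
  rw [map_cosMultiset_cosFamilies] at hmem
  obtain ⟨F, hF, hFG⟩ := List.mem_map.1 hmem
  exact ⟨F, hF, fun θ => (congrFun hFG θ).symm⟩

theorem not_cosEquiv_cosFamilies_cosSporadic (hn : n ≤ 6) (hG : G ∈ cosFamilies n)
    (hψ : ψ ∈ cosSporadic n) (θ : ℚ) : ¬ CosEquiv (G θ) ψ := by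
  obtain ⟨F, hF, hFG⟩ := exists_expFamilies_cosMultiset_eq hG
  have half_period : (cosMultiset (F θ)).map (-·) = cosMultiset (F (θ + 1 / 2)) := by
    simp only [cosMultiset, map_sum_singleton, expFamilies_add hF, cosRat_add_half]
  rw [cosEquiv_iff, hFG, half_period]
  exact not_or.2 ⟨(expFamilies_cosMultiset_ne hn hψ hF θ).symm,
    (expFamilies_cosMultiset_ne hn hψ hF (θ + 1 / 2)).symm⟩

theorem sum_cosRat_cosFamilies (hG : G ∈ cosFamilies n) (θ : ℚ) : ∑ j, cosRat (G θ j) = 0 := by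
  obtain ⟨F, hF, hFG⟩ := exists_expFamilies_cosMultiset_eq hG
  simp only [← sum_cosMultiset, hFG]
  simp only [sum_cosMultiset, ← expRat_re, ← Complex.re_sum, sum_expFamilies hF, Complex.zero_re]

theorem injOn_expRat : Set.InjOn expRat (Set.Ico 0 1) := by
  rintro x ⟨hx0, hx1⟩ y ⟨hy0, hy1⟩ h
  obtain ⟨m, hm⟩ := expRat_eq_iff.1 h
  have hm_fract := congrArg Int.fract hm
  rwa [Int.fract_add_intCast, Int.fract_eq_self.2 ⟨hx0, hx1⟩, Int.fract_eq_self.2 ⟨hy0, hy1⟩]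
    at hm_fract

theorem finite_setOf_re_expRat_mul_eq_zero {z : ℂ} (hz : z ≠ 0) :
    {θ ∈ Set.Ico (0 : ℚ) 1 | (expRat θ * z).re = 0}.Finite := by
  refine Set.Finite.of_finite_image (f := expRat) ?_ (injOn_expRat.mono fun θ h => h.1)
  refine (Polynomial.nthRoots 2 (-starRingEnd ℂ z / z)).toFinset.finite_toSet.subset ?_
  rintro _ ⟨θ, ⟨-, h⟩, rfl⟩
  rw [Finset.mem_coe, Multiset.mem_toFinset, Polynomial.mem_nthRoots two_pos, eq_div_iff hz]
  have hconj := Complex.add_conj (expRat θ * z)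
  rw [h, map_mul, conj_expRat, mul_zero, Complex.ofReal_zero] at hconj
  linear_combination expRat θ * hconj - starRingEnd ℂ z * expRat_mul_expRat_neg θ

theorem IrreducibleExp.finite_not_irreducibleCos (hφ : IrreducibleExp φ) :
    {θ ∈ Set.Ico (0 : ℚ) 1 | ¬ IrreducibleCos fun j => φ j + θ}.Finite := by
  have hfinite : (⋃ E ∈ {E : Finset (Fin n) | E.Nonempty ∧ E ≠ Finset.univ},
      {θ ∈ Set.Ico (0 : ℚ) 1 | (expRat θ * ∑ j ∈ E, expRat (φ j)).re = 0}).Finite :=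
    (Set.toFinite _).biUnion fun E hE => finite_setOf_re_expRat_mul_eq_zero (hφ.2 E hE.1 hE.2)
  have sum_cosRat_add (E : Finset (Fin n)) (θ : ℚ) :
      ∑ j ∈ E, cosRat (φ j + θ) = (expRat θ * ∑ j ∈ E, expRat (φ j)).re := by
    simp only [Finset.mul_sum, Complex.re_sum, ← expRat_add, expRat_re, add_comm θ]
  refine hfinite.subset fun θ ⟨hθ, hred⟩ => ?_
  simp only [Set.mem_iUnion]
  by_contra! hne
  refine hred (irreducibleCos_iff.2 ⟨?_, fun E hE hE' => ?_⟩)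
  · rw [sum_cosRat_add, (irreducibleExp_iff.1 hφ).1, mul_zero, Complex.zero_re]
  · rw [sum_cosRat_add]
    exact fun h => hne E ⟨hE, hE'⟩ ⟨hθ, h⟩

theorem finite_not_irreducibleCos_cosFamilies (hG : G ∈ cosFamilies n) :
    {θ : ℚ | 0 ≤ θ ∧ θ < 1 ∧ ¬ IrreducibleCos (G θ)}.Finite := by
  obtain ⟨F, hF, hFG⟩ := exists_expFamilies_cosMultiset_eq hG
  refine (irreducibleExp_expFamilies hF 0).finite_not_irreducibleCos.subset ?_
  rintro θ ⟨h0, h1, h⟩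
  simp only [← expFamilies_add hF, zero_add]
  exact ⟨⟨h0, h1⟩, fun hirr => h ((irreducibleCos_iff.1 hirr).of_sum_singleton_eq (hFG θ))⟩

end CosFamilies

theorem mainTheorem4 :
    -- the irreducible solutions of the exponential equation with at most six terms
    (∀ n : ℕ, 1 ≤ n → n ≤ 6 → ∀ φ : Fin n → ℚ,
      IrreducibleExp φ ↔ ∃ F ∈ expFamilies n, ∃ θ : ℚ, ExpEquiv (F θ) φ) ∧
    -- the irreducible solutions of the cosine equation with two to six terms
    (∀ n : ℕ, 1 < n → n ≤ 6 →
      -- completeness of the list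
      (∀ φ : Fin n → ℚ, IrreducibleCos φ →
        (∃ ψ ∈ cosSporadic n, CosEquiv ψ φ) ∨
        (∃ F ∈ cosFamilies n, ∃ θ : ℚ, CosEquiv (F θ) φ)) ∧
      -- the sporadic tuples are irreducible solutions, pairwise inequivalent,
      -- and inequivalent to the members of the families
      (∀ ψ ∈ cosSporadic n, IrreducibleCos ψ) ∧
      (cosSporadic n).Pairwise (fun ψ ψ' => ¬ CosEquiv ψ ψ') ∧
      (∀ ψ ∈ cosSporadic n, ∀ F ∈ cosFamilies n, ∀ θ : ℚ, ¬ CosEquiv (F θ) ψ) ∧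
      -- all members of the families are solutions,
      -- irreducible ones with finitely many exceptions modulo 1
      (∀ F ∈ cosFamilies n,
        (∀ θ : ℚ, ∑ j, Real.cos (2 * Real.pi * (F θ j : ℝ)) = 0) ∧
        {θ : ℚ | 0 ≤ θ ∧ θ < 1 ∧ ¬ IrreducibleCos (F θ)}.Finite)) :=
  ⟨fun _ h1 hn _ => ⟨fun hφ => hφ.isListedExp h1 hn, IsListedExp.irreducibleExp⟩,
    fun _ h1 hn =>
      ⟨fun _ hφ => hφ.isListedCos h1 hn,
        fun _ hψ => irreducibleCos_cosSporadic hn hψ,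
        cosSporadic_pairwise_not_cosEquiv hn,
        fun _ hψ _ hF => not_cosEquiv_cosFamilies_cosSporadic hn hF hψ,
        fun _ hF => ⟨sum_cosRat_cosFamilies hF, finite_not_irreducibleCos_cosFamilies hF⟩⟩⟩
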